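/- **Proposition 3.2.** Let $G$ be a locally compact Hausdorff étale groupoid with unit space $G^{(0)}$ and range and source maps $r,s$, and let $C^*(G)$ be its full C*-algebra, i.e. the completion of the convolution $*$-algebra $C_c(G)$, with $$(f*g)(\gamma)=\sum_{r(\alpha)=r(\gamma)}f(\alpha)g(\alpha^{-1}\gamma),\qquad f^*(\gamma)=\overline{f(\gamma^{-1})},$$ in the norm $\|f\|=\sup_\pi\|\pi(f)\|$, where $\pi$ runs over the $*$-representations of $C_c(G)$ on Hilbert spaces with $\|\pi(f)\|\le\max\bigl(\sup_x\sum_{r(\gamma)=x}|f(\gamma)|,\ \sup_x\sum_{s(\gamma)=x}|f(\gamma)|\bigr)$ for all $f$. Let $c:G\to\mathbb R$ be a continuous one-cocycle (a continuous groupoid homomorphism), and let $\alpha^c$ be the one-parameter automorphism group of $C^*(G)$ with $\alpha^c_t(f)=e^{itc}f$ for $f\in C_c(G)$, $t\in\mathbb R$. Assume that the subgroupoid $c^{-1}(0)$ is principal, i.e. $\gamma\mapsto(r(\gamma),s(\gamma))$ is injective on it. Let $\beta\in\mathbb R$ and let $\omega$ be a KMS state for $\alpha^c$ at inverse temperature $\beta$,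 i.e. a state of $C^*(G)$ with $\omega(b\,\alpha^c_{i\beta}(a))=\omega(ab)$ for all $a,b\in C^*(G)$ such that $a$ is entire for $\alpha^c$ (that is, $t\mapsto\alpha^c_t(a)$ extends to an entire function $z\mapsto\alpha^c_z(a)$); if $\beta=0$, assume in addition that $\omega$ is $\alpha^c$-invariant. Then there is a Radon probability measure $\mu$ on $G^{(0)}$ such that: 1. $\omega=\omega_\mu$, i.e. $\omega(f)=\int_{G^{(0)}}f\,d\mu$ for all $f\in C_c(G)$; 2. $\mu$ is quasi-invariant with Radon–Nikodym derivative $dr^*\mu/ds^*\mu=e^{-\beta c}$. Here $r^*\mu$ and $s^*\mu$ are the Radon measures on $G$ given by $\int f\,d(r^*\mu)=\int\sum_{r(\gamma)=x}f(\gamma)\,d\mu(x)$ and $\int f\,d(s^*\mu)=\int\sum_{s(\gamma)=x}f(\gamma)\,d\mu(x)$ for $f\in C_c(G)$, and quasi-invariance means that they are mutually absolutely continuous. -/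

import Mathlib

open Topology Filter
open scoped CompactlySupported ENNReal ComplexOrder

set_option linter.unusedSectionVars false

namespace EtaleKMS

universe u

/-! ### Summation along the fibres of a local homeomorphism -/

section FibreSums

/-- The sum of `f` over the fibre `p ⁻¹' {x}` (a finite sum when `p` is a local homeomorphism
between Hausdorff spaces and `f` has compact support). -/
noncomputable def fibreSum {G X E : Type*} [AddCommMonoid E] (p : G → X) (f : G → E) (x : X) : E :=
  ∑ᶠ α ∈ p ⁻¹' {x}, f α

variable {G X E : Type*} [TopologicalSpace G] [TopologicalSpace X] [T2Space G] [T2Space X]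

/-- The fibres of a local homeomorphism meet compact sets in finite sets. -/
theorem finite_fibre_inter {p : G → X} (hp : IsLocalHomeomorph p) {K : Set G} (hK : IsCompact K)
    (x : X) : (p ⁻¹' {x} ∩ K).Finite := by
  have hc : IsCompact (p ⁻¹' {x} ∩ K) :=
    hK.inter_left (isClosed_singleton.preimage hp.continuous)
  refine hc.finite ?_
  have : IsDiscrete (p ⁻¹' {x}) := by
    rw [isDiscrete_iff_forall_mem_exists_isOpen]
    intro α hα
    obtain ⟨e, he, rfl⟩ := hp α
    refine ⟨e.source, e.open_source, ?_⟩
    ext β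
    constructor
    · rintro ⟨h1, h2⟩
      exact e.injOn h1 he (by rw [h2, hα])
    · rintro rfl
      exact ⟨he, hα⟩
  exact this.mono Set.inter_subset_left

/-- A fibrewise sum of continuous functions depending on a parameter is continuous in the
parameter. -/
theorem continuous_fibreSum [AddCommMonoid E] [TopologicalSpace E] [ContinuousAdd E]
    {p : G → X} (hp : IsLocalHomeomorph p) {T : Type*} [TopologicalSpace T] {ρ : T → X}
    (hρ : Continuous ρ) {F : G → T → E}
    (hF : ContinuousOn (fun q : G × T => F q.1 q.2) {q | p q.1 = ρ q.2})
    {K : Set G} (hK : IsCompact K) (hFK : ∀ α t, p α = ρ t → α ∉ K → F α t = 0) :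
    Continuous fun t => fibreSum p (fun α => F α t) (ρ t) := by
  classical
  rw [continuous_iff_continuousAt]
  intro t₀
  have hfin := finite_fibre_inter hp hK (ρ t₀)
  set S := hfin.toFinset with hS
  have hmemS : ∀ α, α ∈ S ↔ p α = ρ t₀ ∧ α ∈ K := by intro α; simp [hS]
  obtain ⟨U, hU, hdisj⟩ := Set.Finite.t2_separation S.finite_toSet
  choose e he hpe using hp
  -- the neighbourhoods on which `p` is injective
  set V : G → Set G := fun α => U α ∩ (e α).source with hV
  have hVo : ∀ α, IsOpen (V α) := fun α => (hU α).2.inter (e α).open_source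
  have hp' : IsLocalHomeomorph p := fun α => ⟨e α, he α, hpe α⟩
  have hpinj : ∀ α, Set.InjOn p (V α) := by
    intro α β hβ γ hγ h
    rw [hpe α] at h
    exact (e α).injOn hβ.2 hγ.2 h
  have hW : IsClosed (p '' (K \ ⋃ α ∈ S, V α)) :=
    ((hK.diff (isOpen_biUnion fun α _ => hVo α)).image hp'.continuous).isClosed
  have hev1 : ∀ᶠ t in 𝓝 t₀, ρ t ∉ p '' (K \ ⋃ α ∈ S, V α) := by
    refine hρ.continuousAt.eventually (hW.isOpen_compl.mem_nhds ?_)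
    rintro ⟨α, ⟨hαK, hα⟩, hαt⟩
    refine hα (Set.mem_biUnion ((hmemS α).2 ⟨hαt, hαK⟩) ⟨(hU α).1, he α⟩)
  have hσ : ∀ α ∈ S, ContinuousAt (fun t => (e α).symm (ρ t)) t₀ := by
    intro α hα
    have h1 : ρ t₀ ∈ (e α).target := by
      rw [← ((hmemS α).1 hα).1, hpe α]; exact (e α).map_source (he α)
    exact ((e α).continuousAt_symm h1).comp hρ.continuousAt
  have hσ0 : ∀ α ∈ S, (e α).symm (ρ t₀) = α := by
    intro α hα
    rw [← ((hmemS α).1 hα).1]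
    conv_lhs => rw [hpe α]
    exact (e α).left_inv (he α)
  have hev2 : ∀ᶠ t in 𝓝 t₀, ∀ α ∈ S, ρ t ∈ (e α).target ∧ (e α).symm (ρ t) ∈ V α := by
    rw [Filter.eventually_all_finset]
    intro α hα
    have h1 : ρ t₀ ∈ (e α).target := by
      rw [← ((hmemS α).1 hα).1, hpe α]; exact (e α).map_source (he α)
    refine (hρ.continuousAt.eventually ((e α).open_target.mem_nhds h1)).and ?_
    refine (hσ α hα).eventually ((hVo α).mem_nhds ?_)
    change (e α).symm (ρ t₀) ∈ V α
    rw [hσ0 α hα]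
    exact ⟨(hU α).1, he α⟩
  have hpσ : ∀ α t, ρ t ∈ (e α).target → p ((e α).symm (ρ t)) = ρ t := by
    intro α t h
    conv_lhs => rw [hpe α]
    exact (e α).right_inv h
  have key : (fun t => fibreSum p (fun α => F α t) (ρ t)) =ᶠ[𝓝 t₀]
      fun t => ∑ α ∈ S, F ((e α).symm (ρ t)) t := by
    filter_upwards [hev1, hev2] with t h1 h2
    have hinj : Set.InjOn (fun α => (e α).symm (ρ t)) (S : Set G) := by
      intro α hα β hβ hab
      by_contra hne
      have hd := hdisj hα hβ hne
      refine Set.disjoint_left.1 hd (h2 α hα).2.1 ?_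
      have := (h2 β hβ).2.1
      simp only at hab
      rwa [← hab] at this
    rw [← Finset.sum_image (f := fun β => F β t) hinj]
    unfold fibreSum
    refine finsum_mem_eq_sum_of_inter_support_eq _ ?_
    ext β
    simp only [Set.mem_inter_iff, Set.mem_preimage, Set.mem_singleton_iff, Function.mem_support,
      Finset.coe_image, Set.mem_image, Finset.mem_coe]
    constructor
    · rintro ⟨hβ, hne⟩
      refine ⟨?_, hne⟩
      have hβK : β ∈ K := by
        by_contra hcon
        exact hne (hFK β t hβ hcon)
      have : β ∈ ⋃ α ∈ S, V α := by
        by_contra hcon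
        exact h1 ⟨β, ⟨hβK, hcon⟩, hβ⟩
      simp only [Set.mem_iUnion] at this
      obtain ⟨α, hα, hβα⟩ := this
      exact ⟨α, hα, hpinj α (h2 α hα).2 hβα (by rw [hpσ α t (h2 α hα).1, hβ])⟩
    · rintro ⟨⟨α, hα, rfl⟩, hne⟩
      exact ⟨hpσ α t (h2 α hα).1, hne⟩
  refine ContinuousAt.congr ?_ key.symm
  refine tendsto_finsetSum _ fun α hα => ?_
  have hmem : (α, t₀) ∈ {q : G × T | p q.1 = ρ q.2} := ((hmemS α).1 hα).1
  have hc := (hF _ hmem).tendsto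
  have h3 : Tendsto (fun t => ((e α).symm (ρ t), t)) (𝓝 t₀)
      (𝓝[{q : G × T | p q.1 = ρ q.2}] (α, t₀)) := by
    refine tendsto_nhdsWithin_iff.2 ⟨?_, ?_⟩
    · have := ((hσ α hα).tendsto.prodMk_nhds tendsto_id)
      rwa [hσ0 α hα] at this
    · filter_upwards [hev2] with t h2
      exact hpσ α t (h2 α hα).1
  have := hc.comp h3
  simpa [hσ0 α hα, Function.comp_def, ContinuousAt] using this

theorem fibreSum_eq_zero [AddCommMonoid E] {p : G → X} {f : G → E} {x : X}
    (h : ∀ α, p α = x → f α = 0) : fibreSum p f x = 0 :=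
  finsum_mem_eq_zero_of_forall_eq_zero fun α hα => h α hα

/-- Summing a compactly supported continuous function along the fibres of a local homeomorphism
gives a compactly supported continuous function. -/
noncomputable def fibreSumCc [AddCommMonoid E] [TopologicalSpace E] [ContinuousAdd E]
    (p : G → X) (hp : IsLocalHomeomorph p) (f : C_c(G, E)) : C_c(X, E) where
  toFun := fibreSum p f
  continuous_toFun := by
    refine continuous_fibreSum (F := fun α _ => f α) hp continuous_id ?_ f.hasCompactSupport ?_
    · exact (f.continuous.comp continuous_fst).continuousOn
    · intro α _ _ hα
      exact image_eq_zero_of_notMem_tsupport hα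
  hasCompactSupport' := by
    refine HasCompactSupport.intro (f.hasCompactSupport.isCompact.image hp.continuous)
      fun x hx => fibreSum_eq_zero fun α hα => ?_
    by_contra hne
    exact hx ⟨α, subset_tsupport _ hne, hα⟩

theorem finite_fibre_support [AddCommMonoid E] [TopologicalSpace E] {p : G → X}
    (hp : IsLocalHomeomorph p) (f : C_c(G, E)) (x : X) :
    (p ⁻¹' {x} ∩ Function.support f).Finite :=
  (finite_fibre_inter hp f.hasCompactSupport x).subset
    (Set.inter_subset_inter_right _ (subset_tsupport _))

end FibreSums

/-! ### Étale groupoids -/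

/-- A groupoid, presented by its set `G` of arrows, with range and source maps `r` and `s` taking
values in the units. The product `a * b` is meaningful only when `s a = r b`; its values on
other pairs are irrelevant and subject to no condition. -/
class ArrowGroupoid (G : Type u) extends Mul G, Inv G where
  r : G → G
  s : G → G
  r_r : ∀ a, r (r a) = r a
  s_r : ∀ a, s (r a) = r a
  r_s : ∀ a, r (s a) = s a
  s_s : ∀ a, s (s a) = s a
  r_mul : ∀ a b, s a = r b → r (a * b) = r a
  s_mul : ∀ a b, s a = r b → s (a * b) = s b
  mul_assoc' : ∀ a b c, s a = r b → s b = r c → a * b * c = a * (b * c)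
  r_mul_self : ∀ a, r a * a = a
  mul_s_self : ∀ a, a * s a = a
  r_inv : ∀ a, r a⁻¹ = s a
  s_inv : ∀ a, s a⁻¹ = r a
  mul_inv' : ∀ a, a * a⁻¹ = r a
  inv_mul_self' : ∀ a, a⁻¹ * a = s a

open ArrowGroupoid

/-- The unit space `G⁽⁰⁾`, as a subset of `G` (with the subspace topology). -/
def unitSpace (G : Type u) [ArrowGroupoid G] : Set G := {x | r x = x}

/-- The range map `r : G → G⁽⁰⁾`. -/
def rMap (G : Type u) [ArrowGroupoid G] (a : G) : unitSpace G := ⟨r a, r_r a⟩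

/-- The source map `s : G → G⁽⁰⁾`. -/
def sMap (G : Type u) [ArrowGroupoid G] (a : G) : unitSpace G := ⟨s a, r_s a⟩

/-- An étale groupoid: a topological groupoid whose range map `r : G → G⁽⁰⁾` is a local
homeomorphism (then so is the source map, being the composition of `r` with the inversion). -/
class EtaleGroupoid (G : Type u) [TopologicalSpace G] extends ArrowGroupoid G where
  continuous_inv' : Continuous fun a : G => a⁻¹
  continuousOn_mul' : ContinuousOn (fun q : G × G => q.1 * q.2) {q | s q.1 = r q.2}
  isLocalHomeomorph_rMap : IsLocalHomeomorph (rMap G)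

open EtaleGroupoid

section Etale

variable {G : Type u} [TopologicalSpace G] [EtaleGroupoid G]

theorem inv_inv' (a : G) : a⁻¹⁻¹ = a := by
  have h1 : a⁻¹⁻¹ * a⁻¹ * a = a⁻¹⁻¹ * (a⁻¹ * a) :=
    mul_assoc' _ _ _ (by rw [s_inv]) (by rw [s_inv])
  rw [inv_mul_self', inv_mul_self', s_inv, r_mul_self] at h1
  have h2 := mul_s_self (a⁻¹⁻¹)
  rw [s_inv, r_inv] at h2
  exact h2.symm.trans h1.symm

theorem sMap_eq : sMap G = rMap G ∘ fun a => a⁻¹ := by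
  ext a
  simp [sMap, rMap, r_inv]

theorem isLocalHomeomorph_sMap : IsLocalHomeomorph (sMap G) := by
  rw [sMap_eq]
  let e : G ≃ₜ G :=
    { toFun := fun a => a⁻¹, invFun := fun a => a⁻¹, left_inv := inv_inv', right_inv := inv_inv'
      continuous_toFun := continuous_inv', continuous_invFun := continuous_inv' }
  exact (isLocalHomeomorph_rMap (G := G)).comp e.isLocalHomeomorph

theorem continuous_r : Continuous (r : G → G) :=
  continuous_subtype_val.comp (isLocalHomeomorph_rMap (G := G)).continuous

theorem continuous_s : Continuous (s : G → G) :=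
  continuous_subtype_val.comp (isLocalHomeomorph_sMap (G := G)).continuous

/-! ### The convolution algebra `C_c(G)` -/

variable [T2Space G]

/-- Convolution on `C_c(G)`: `(f ⋆ g)(γ) = ∑_{r(α) = r(γ)} f(α) g(α⁻¹γ)`. -/
noncomputable def conv (f g : C_c(G, ℂ)) : C_c(G, ℂ) where
  toFun γ := fibreSum (rMap G) (fun α => f α * g (α⁻¹ * γ)) (rMap G γ)
  continuous_toFun := by
    refine continuous_fibreSum (F := fun α γ => f α * g (α⁻¹ * γ)) isLocalHomeomorph_rMap
      isLocalHomeomorph_rMap.continuous ?_ f.hasCompactSupport ?_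
    · refine (f.continuous.comp continuous_fst).continuousOn.mul
        (g.continuous.comp_continuousOn ?_)
      refine continuousOn_mul'.comp (f := fun q : G × G => (q.1⁻¹, q.2))
        ((continuous_inv'.comp continuous_fst).prodMk continuous_snd).continuousOn ?_
      intro q hq
      have := congrArg Subtype.val hq
      simpa [rMap, s_inv] using this
    · intro α t _ hα
      rw [image_eq_zero_of_notMem_tsupport hα, zero_mul]
  hasCompactSupport' := by
    have hcl : IsClosed {q : G × G | s q.1 = r q.2} :=
      isClosed_eq (continuous_s.comp continuous_fst) (continuous_r.comp continuous_snd)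
    have hK : IsCompact ((tsupport f ×ˢ tsupport g) ∩ {q : G × G | s q.1 = r q.2}) :=
      (f.hasCompactSupport.isCompact.prod g.hasCompactSupport.isCompact).inter_right hcl
    refine HasCompactSupport.intro
      (hK.image_of_continuousOn (continuousOn_mul'.mono Set.inter_subset_right)) ?_
    intro γ hγ
    refine fibreSum_eq_zero fun α hα => ?_
    by_contra hne
    have hα' : r α = r γ := congrArg Subtype.val hα
    refine hγ ⟨(α, α⁻¹ * γ), ⟨⟨subset_tsupport _ (left_ne_zero_of_mul hne),
      subset_tsupport _ (right_ne_zero_of_mul hne)⟩, ?_⟩, ?_⟩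
    · change s α = r (α⁻¹ * γ)
      rw [r_mul _ _ (by rw [s_inv, hα']), r_inv]
    · change α * (α⁻¹ * γ) = γ
      rw [← mul_assoc' _ _ _ (by rw [r_inv]) (by rw [s_inv, hα']), mul_inv', hα', r_mul_self]

/-- The involution of `C_c(G)`: `f*(γ) = conj (f(γ⁻¹))`. -/
noncomputable def invol (f : C_c(G, ℂ)) : C_c(G, ℂ) where
  toFun γ := star (f γ⁻¹)
  continuous_toFun := continuous_star.comp (f.continuous.comp continuous_inv')
  hasCompactSupport' := by
    refine HasCompactSupport.intro (f.hasCompactSupport.isCompact.image continuous_inv') ?_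
    intro γ hγ
    have : f γ⁻¹ = 0 := by
      by_contra hne
      exact hγ ⟨γ⁻¹, subset_tsupport _ hne, inv_inv' γ⟩
    simp [this]

/-- The function `|f|`, as an element of `C_c(G, ℝ)`. -/
noncomputable def absCc (f : C_c(G, ℂ)) : C_c(G, ℝ) where
  toFun γ := ‖f γ‖
  continuous_toFun := f.continuous.norm
  hasCompactSupport' := f.hasCompactSupport.norm

/-- The norm `‖f‖_I = max (sup_x ∑_{r(γ)=x} |f(γ)|, sup_x ∑_{s(γ)=x} |f(γ)|)` on `C_c(G)`. -/
noncomputable def INorm (f : C_c(G, ℂ)) : ℝ :=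
  max (⨆ x : unitSpace G, fibreSum (rMap G) (fun γ => ‖f γ‖) x)
    (⨆ x : unitSpace G, fibreSum (sMap G) (fun γ => ‖f γ‖) x)

/-- The suprema in the definition of `‖f‖_I` are finite. -/
theorem bddAbove_fibreSum {p : G → unitSpace G} (hp : IsLocalHomeomorph p) (f : C_c(G, ℂ)) :
    BddAbove (Set.range fun x : unitSpace G => fibreSum p (fun γ => ‖f γ‖) x) := by
  have h := (fibreSumCc p hp (absCc f)).hasCompactSupport.isCompact_range
    (fibreSumCc p hp (absCc f)).continuous
  exact h.bddAbove

/-! ### The full C⋆-algebra of an étale groupoid -/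

end Etale

/-- A bounded representation of the convolution ⋆-algebra `C_c(G)` on a Hilbert space. -/
structure BoundedRep (G : Type u) [TopologicalSpace G] [EtaleGroupoid G] [T2Space G] where
  H : Type u
  [instNormed : NormedAddCommGroup H]
  [instInner : InnerProductSpace ℂ H]
  [instComplete : CompleteSpace H]
  toLin : C_c(G, ℂ) →ₗ[ℂ] (H →L[ℂ] H)
  map_conv : ∀ f g, toLin (conv f g) = toLin f * toLin g
  map_invol : ∀ f, toLin (invol f) = star (toLin f)
  norm_le : ∀ f, ‖toLin f‖ ≤ INorm f

attribute [instance] BoundedRep.instNormed BoundedRep.instInner BoundedRep.instComplete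

section CStar

variable (G : Type u) [TopologicalSpace G] [EtaleGroupoid G] [T2Space G]

/-- The `ℓ^∞`-product of the C⋆-algebras `B(H_π)` over all bounded representations `π`. -/
def RepProduct : Type (u + 1) := lp (fun π : BoundedRep G => π.H →L[ℂ] π.H) ∞

noncomputable instance : NonUnitalCStarAlgebra (RepProduct G) :=
  inferInstanceAs (NonUnitalCStarAlgebra (lp (fun π : BoundedRep G => π.H →L[ℂ] π.H) ∞))

variable {G}

/-- The component of `x` at the representation `π`. -/
def RepProduct.app (x : RepProduct G) (π : BoundedRep G) : π.H →L[ℂ] π.H := x.1 π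

theorem RepProduct.ext {x y : RepProduct G} (h : ∀ π, x.app π = y.app π) : x = y :=
  Subtype.ext (funext h)

/-- An element of the product from a uniformly bounded family of components. -/
def RepProduct.mk (x : ∀ π : BoundedRep G, π.H →L[ℂ] π.H) (C : ℝ) (hx : ∀ π, ‖x π‖ ≤ C) :
    RepProduct G :=
  ⟨x, memℓp_infty ⟨C, by rintro _ ⟨π, rfl⟩; exact hx π⟩⟩

theorem RepProduct.norm_app_le (x : RepProduct G) (π : BoundedRep G) : ‖x.app π‖ ≤ ‖x‖ :=
  lp.norm_apply_le_norm ENNReal.top_ne_zero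
    (E := fun π : BoundedRep G => π.H →L[ℂ] π.H) (p := ∞) x π

theorem RepProduct.norm_le {x : RepProduct G} {C : ℝ} (hC : 0 ≤ C) (h : ∀ π, ‖x.app π‖ ≤ C) :
    ‖x‖ ≤ C :=
  lp.norm_le_of_forall_le (E := fun π : BoundedRep G => π.H →L[ℂ] π.H) hC h

/-- The direct sum of all bounded representations of `C_c(G)`. -/
noncomputable def univRep : C_c(G, ℂ) →ₗ[ℂ] RepProduct G where
  toFun f := RepProduct.mk (fun π => π.toLin f) (INorm f) fun π => π.norm_le f
  map_add' f g := RepProduct.ext fun π => map_add π.toLin f g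
  map_smul' a f := RepProduct.ext fun π => map_smul π.toLin a f

variable (G) in
/-- The image of `C_c(G)` in the product of all bounded representations. -/
noncomputable def univRepRange : NonUnitalStarSubalgebra ℂ (RepProduct G) where
  carrier := Set.range univRep
  add_mem' := by rintro _ _ ⟨f, rfl⟩ ⟨g, rfl⟩; exact ⟨f + g, map_add _ _ _⟩
  zero_mem' := ⟨0, map_zero _⟩
  mul_mem' := by
    rintro _ _ ⟨f, rfl⟩ ⟨g, rfl⟩
    exact ⟨conv f g, RepProduct.ext fun π => π.map_conv f g⟩
  smul_mem' := by rintro a _ ⟨f, rfl⟩; exact ⟨a • f, map_smul _ _ _⟩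
  star_mem' := by
    rintro _ ⟨f, rfl⟩
    exact ⟨invol f, RepProduct.ext fun π => π.map_invol f⟩

variable (G) in
/-- The full C⋆-algebra `C*(G)`: the completion of `C_c(G)` in the norm
`‖f‖ = sup_π ‖π(f)‖`, the supremum being over all bounded representations. It is realised as the
closure of the image of `C_c(G)` in the `ℓ^∞`-product of these representations. -/
def GroupoidCStar : Type (u + 1) := (univRepRange G).topologicalClosure

noncomputable instance : NonUnitalCStarAlgebra (GroupoidCStar G) :=
  haveI : IsClosed ((univRepRange G).topologicalClosure : Set (RepProduct G)) :=
    (univRepRange G).isClosed_topologicalClosure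
  inferInstanceAs (NonUnitalCStarAlgebra (univRepRange G).topologicalClosure)

/-- The canonical map `C_c(G) → C*(G)`. -/
noncomputable def toCStar : C_c(G, ℂ) →ₗ[ℂ] GroupoidCStar G where
  toFun f := ⟨univRep f, (univRepRange G).le_topologicalClosure ⟨f, rfl⟩⟩
  map_add' f g := Subtype.ext (map_add univRep f g)
  map_smul' a f := Subtype.ext (map_smul univRep a f)

theorem toCStar_conv (f g : C_c(G, ℂ)) : toCStar (conv f g) = toCStar f * toCStar g :=
  Subtype.ext (RepProduct.ext fun π => π.map_conv f g)

theorem toCStar_invol (f : C_c(G, ℂ)) : toCStar (invol f) = star (toCStar f) :=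
  Subtype.ext (RepProduct.ext fun π => π.map_invol f)

theorem denseRange_toCStar : DenseRange (toCStar (G := G)) := by
  intro x
  refine closure_subtype.2 ?_
  refine closure_mono ?_ x.2
  rintro _ ⟨f, rfl⟩
  exact ⟨toCStar f, ⟨f, rfl⟩, rfl⟩

end CStar

/-! ### Cocycles and their one-parameter automorphism groups -/

/-- A continuous real-valued one-cocycle, i.e. a continuous groupoid homomorphism `G → ℝ`. -/
structure RealCocycle (G : Type u) [TopologicalSpace G] [EtaleGroupoid G] where
  toFun : G → ℝ
  continuous_toFun : Continuous toFun
  map_mul' : ∀ a b, s a = r b → toFun (a * b) = toFun a + toFun b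

section Action

variable {G : Type u} [TopologicalSpace G] [EtaleGroupoid G]

instance : CoeFun (RealCocycle G) fun _ => G → ℝ := ⟨RealCocycle.toFun⟩

theorem RealCocycle.map_r (c : RealCocycle G) (a : G) : c (r a) = 0 := by
  have := c.map_mul' (r a) a (s_r a)
  rw [r_mul_self] at this
  linarith

theorem RealCocycle.map_inv (c : RealCocycle G) (a : G) : c a⁻¹ = -c a := by
  have := c.map_mul' a a⁻¹ (r_inv a).symm
  rw [mul_inv', c.map_r] at this
  linarith

/-- A subset (in practice a subgroupoid) of `G` is principal if each of its elements is determined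
by its range and source. -/
def IsPrincipal (H : Set G) : Prop := Set.InjOn (fun γ => (r γ, s γ)) H

/-- The function `e^{itc} f`. -/
noncomputable def twist (c : RealCocycle G) (t : ℝ) (f : C_c(G, ℂ)) : C_c(G, ℂ) where
  toFun γ := Complex.exp (Complex.I * t * c γ) * f γ
  continuous_toFun := by
    have := c.continuous_toFun
    have := f.continuous
    fun_prop
  hasCompactSupport' := f.hasCompactSupport.mul_left

theorem norm_twist (c : RealCocycle G) (t : ℝ) (f : C_c(G, ℂ)) (γ : G) :
    ‖twist c t f γ‖ = ‖f γ‖ := by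
  change ‖Complex.exp (Complex.I * t * c γ) * f γ‖ = ‖f γ‖
  rw [norm_mul, mul_assoc, mul_comm Complex.I, ← Complex.ofReal_mul,
    Complex.norm_exp_ofReal_mul_I, one_mul]

theorem twist_add (c : RealCocycle G) (t u : ℝ) (f : C_c(G, ℂ)) :
    twist c (t + u) f = twist c t (twist c u f) := by
  ext γ
  change Complex.exp _ * _ = Complex.exp _ * (Complex.exp _ * _)
  rw [← mul_assoc, ← Complex.exp_add]
  congr 2
  push_cast
  ring

theorem twist_zero (c : RealCocycle G) (f : C_c(G, ℂ)) : twist c 0 f = f := by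
  ext γ
  change Complex.exp _ * _ = _
  simp

variable [T2Space G]

theorem twist_conv (c : RealCocycle G) (t : ℝ) (f g : C_c(G, ℂ)) :
    twist c t (conv f g) = conv (twist c t f) (twist c t g) := by
  ext γ
  change Complex.exp _ * (∑ᶠ α ∈ (rMap G) ⁻¹' {rMap G γ}, f α * g (α⁻¹ * γ)) =
    ∑ᶠ α ∈ (rMap G) ⁻¹' {rMap G γ}, (Complex.exp _ * f α) * (Complex.exp _ * g (α⁻¹ * γ))
  simp only [← smul_eq_mul (Complex.exp (Complex.I * t * c γ)), smul_finsum]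
  refine finsum_congr fun α => finsum_congr fun hα => ?_
  have hα' : r α = r γ := congrArg Subtype.val hα
  have hc : c (α⁻¹ * γ) = c γ - c α := by
    rw [c.map_mul' _ _ (by rw [s_inv, hα']), c.map_inv]; ring
  rw [hc, smul_eq_mul]
  have : Complex.exp (Complex.I * t * c γ) =
      Complex.exp (Complex.I * t * c α) * Complex.exp (Complex.I * t * (c γ - c α : ℝ)) := by
    rw [← Complex.exp_add]; congr 1; push_cast; ring
  rw [this]
  ring

theorem twist_invol (c : RealCocycle G) (t : ℝ) (f : C_c(G, ℂ)) :
    twist c t (invol f) = invol (twist c t f) := by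
  ext γ
  change Complex.exp _ * star (f γ⁻¹) = star (Complex.exp _ * f γ⁻¹)
  rw [star_mul', c.map_inv]
  congr 1
  rw [Complex.star_def, ← Complex.exp_conj]
  congr 1
  simp

theorem INorm_twist (c : RealCocycle G) (t : ℝ) (f : C_c(G, ℂ)) :
    INorm (twist c t f) = INorm f := by
  simp only [INorm, norm_twist]

/-- The representation `f ↦ π(e^{itc} f)`. -/
noncomputable def BoundedRep.twist (c : RealCocycle G) (t : ℝ) (π : BoundedRep G) :
    BoundedRep G where
  H := π.H
  toLin :=
    { toFun := fun f => π.toLin (EtaleKMS.twist c t f)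
      map_add' := fun f g => by
        rw [← map_add]; congr 1; ext γ; exact mul_add _ _ _
      map_smul' := fun a f => by
        rw [← map_smul]; congr 1; ext γ; exact mul_left_comm _ _ _ }
  map_conv f g := by
    change π.toLin _ = π.toLin _ * π.toLin _
    rw [twist_conv, π.map_conv]
  map_invol f := by
    change π.toLin _ = star (π.toLin _)
    rw [twist_invol, π.map_invol]
  norm_le f := (π.norm_le _).trans_eq (INorm_twist c t f)

theorem RepProduct.app_congr (x : RepProduct G) (π : BoundedRep G)
    (L : C_c(G, ℂ) →ₗ[ℂ] (π.H →L[ℂ] π.H)) (h : L = π.toLin) (h1 h2 h3) :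
    (x.app (BoundedRep.mk π.H L h1 h2 h3) : π.H →L[ℂ] π.H) = x.app π := by
  subst h
  rfl

/-- The ⋆-endomorphism of the product that permutes the components by `π ↦ π(e^{itc} ·)`. -/
noncomputable def productAction (c : RealCocycle G) (t : ℝ) (x : RepProduct G) : RepProduct G :=
  RepProduct.mk (fun π => x.app (π.twist c t)) ‖x‖ fun π => x.norm_app_le (π.twist c t)

theorem productAction_add (c : RealCocycle G) (t u : ℝ) (x : RepProduct G) :
    productAction c (t + u) x = productAction c t (productAction c u x) := by
  refine RepProduct.ext fun π => ?_
  refine (RepProduct.app_congr x ((π.twist c t).twist c u) (π.twist c (t + u)).toLin ?_ _ _ _)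
  ext1 f
  change π.toLin _ = π.toLin _
  rw [twist_add]

theorem productAction_zero (c : RealCocycle G) (x : RepProduct G) :
    productAction c 0 x = x := by
  refine RepProduct.ext fun π => ?_
  refine (RepProduct.app_congr x π (π.twist c 0).toLin ?_ _ _ _)
  ext1 f
  change π.toLin _ = π.toLin _
  rw [twist_zero]

theorem productAction_univRep (c : RealCocycle G) (t : ℝ) (f : C_c(G, ℂ)) :
    productAction c t (univRep f) = univRep (twist c t f) := rfl

theorem continuous_productAction (c : RealCocycle G) (t : ℝ) :
    Continuous (productAction c t) := by
  let φ : RepProduct G →+ RepProduct G :=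
    { toFun := productAction c t, map_zero' := rfl, map_add' := fun _ _ => rfl }
  refine AddMonoidHomClass.continuous_of_bound φ 1 fun x => ?_
  rw [one_mul]
  exact RepProduct.norm_le (norm_nonneg _) fun π => x.norm_app_le (π.twist c t)

theorem productAction_mem (c : RealCocycle G) (t : ℝ) {x : RepProduct G}
    (hx : x ∈ (univRepRange G).topologicalClosure) :
    productAction c t x ∈ (univRepRange G).topologicalClosure := by
  refine map_mem_closure (continuous_productAction c t) hx ?_
  rintro _ ⟨f, rfl⟩
  exact ⟨twist c t f, rfl⟩

/-- The automorphism `α^c_t` of `C*(G)`, determined by `α^c_t(f) = e^{itc} f` on `C_c(G)`. -/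
noncomputable def cocycleAction (c : RealCocycle G) (t : ℝ) :
    GroupoidCStar G ≃⋆ₐ[ℂ] GroupoidCStar G where
  toFun x := ⟨productAction c t x.1, productAction_mem c t x.2⟩
  invFun x := ⟨productAction c (-t) x.1, productAction_mem c (-t) x.2⟩
  left_inv x := Subtype.ext (by
    change productAction c (-t) (productAction c t x.1) = x.1
    rw [← productAction_add, neg_add_cancel, productAction_zero])
  right_inv x := Subtype.ext (by
    change productAction c t (productAction c (-t) x.1) = x.1
    rw [← productAction_add, add_neg_cancel, productAction_zero])
  map_mul' _ _ := rfl
  map_add' _ _ := rfl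
  map_star' _ := rfl
  map_smul' _ _ := rfl

theorem cocycleAction_toCStar (c : RealCocycle G) (t : ℝ) (f : C_c(G, ℂ)) :
    cocycleAction c t (toCStar f) = toCStar (twist c t f) := rfl

theorem cocycleAction_add (c : RealCocycle G) (t u : ℝ) (x : GroupoidCStar G) :
    cocycleAction c (t + u) x = cocycleAction c t (cocycleAction c u x) :=
  Subtype.ext (productAction_add c t u x.1)

end Action

/-! ### KMS states -/

section KMS

variable {A : Type*} [NonUnitalCStarAlgebra A]

/-- A state: a positive linear functional of norm one. -/
structure IsState (ω : A →L[ℂ] ℂ) : Prop where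
  nonneg : ∀ a, 0 ≤ ω (star a * a)
  norm_eq_one : ‖ω‖ = 1

/-- `F` is the entire extension `z ↦ α_z(a)` of the orbit map `t ↦ α_t(a)`; the element `a` is
entire for `α` if such an `F` exists (`F` is then unique). -/
def IsEntireExtension (α : ℝ → A ≃⋆ₐ[ℂ] A) (a : A) (F : ℂ → A) : Prop :=
  Differentiable ℂ F ∧ ∀ t : ℝ, F t = α t a

/-- A state `ω` satisfies the KMS condition for `α` at inverse temperature `β` if
`ω(b α_{iβ}(a)) = ω(ab)` for all `a`, `b` with `a` entire for `α`. -/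
structure IsKMSState (α : ℝ → A ≃⋆ₐ[ℂ] A) (β : ℝ) (ω : A →L[ℂ] ℂ) : Prop extends IsState ω where
  kms : ∀ (a b : A) (F : ℂ → A), IsEntireExtension α a F →
    ω (b * F (Complex.I * β)) = ω (a * b)

end KMS

/-! ### Quasi-invariant measures -/

section Measures

open MeasureTheory

variable {G : Type u} [TopologicalSpace G] [EtaleGroupoid G] [T2Space G]
  [MeasurableSpace G] [BorelSpace G]

theorem fibreSum_add_apply {p : G → unitSpace G} (hp : IsLocalHomeomorph p) (f g : C_c(G, ℝ))
    (x : unitSpace G) :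
    fibreSumCc p hp (f + g) x = fibreSumCc p hp f x + fibreSumCc p hp g x :=
  finsum_mem_add_distrib' (finite_fibre_support hp f x) (finite_fibre_support hp g x)

theorem fibreSum_smul_apply {p : G → unitSpace G} (hp : IsLocalHomeomorph p) (a : ℝ)
    (f : C_c(G, ℝ)) (x : unitSpace G) :
    fibreSumCc p hp (a • f) x = a * fibreSumCc p hp f x := by
  change ∑ᶠ α ∈ p ⁻¹' {x}, a • f α = a • ∑ᶠ α ∈ p ⁻¹' {x}, f α
  simp only [smul_finsum]

theorem integrable_fibreSum {p : G → unitSpace G} (hp : IsLocalHomeomorph p) (f : C_c(G, ℝ))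
    (μ : Measure (unitSpace G)) [IsFiniteMeasure μ] :
    Integrable (fun x => fibreSumCc p hp f x) μ :=
  (fibreSumCc p hp f).continuous.integrable_of_hasCompactSupport
    (fibreSumCc p hp f).hasCompactSupport

/-- The positive functional `f ↦ ∫ ∑_{p(γ) = x} f(γ) dμ(x)` on `C_c(G)`. -/
noncomputable def fibreFunctional (p : G → unitSpace G) (hp : IsLocalHomeomorph p)
    (μ : Measure (unitSpace G)) [IsFiniteMeasure μ] : C_c(G, ℝ) →ₚ[ℝ] ℝ :=
  PositiveLinearMap.mk₀
    { toFun := fun f => ∫ x, fibreSum p f x ∂μ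
      map_add' := fun f g => by
        refine Eq.trans ?_
          (integral_add (integrable_fibreSum hp f μ) (integrable_fibreSum hp g μ))
        exact integral_congr_ae (.of_forall fun x => fibreSum_add_apply hp f g x)
      map_smul' := fun a f => by
        change _ = a * _
        rw [← integral_const_mul]
        exact integral_congr_ae (.of_forall fun x => fibreSum_smul_apply hp a f x) }
    fun f hf => integral_nonneg fun x => finsum_nonneg fun α => finsum_nonneg fun _ => hf α

variable [LocallyCompactSpace G]

/-- The Radon measure `r^*μ` on `G`, given by
`∫ f d(r^*μ) = ∫ ∑_{r(γ) = x} f(γ) dμ(x)` for `f ∈ C_c(G)`. -/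
noncomputable def rStar (μ : Measure (unitSpace G)) [IsFiniteMeasure μ] : Measure G :=
  RealRMK.rieszMeasure (fibreFunctional (rMap G) isLocalHomeomorph_rMap μ)

/-- The Radon measure `s^*μ` on `G`, given by
`∫ f d(s^*μ) = ∫ ∑_{s(γ) = x} f(γ) dμ(x)` for `f ∈ C_c(G)`. -/
noncomputable def sStar (μ : Measure (unitSpace G)) [IsFiniteMeasure μ] : Measure G :=
  RealRMK.rieszMeasure (fibreFunctional (sMap G) isLocalHomeomorph_sMap μ)

/-- `μ` is quasi-invariant if `r^*μ` and `s^*μ` are equivalent. -/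
def IsQuasiInvariant (μ : Measure (unitSpace G)) [IsFiniteMeasure μ] : Prop :=
  rStar μ ≪ sStar μ ∧ sStar μ ≪ rStar μ

/-- `dr^*μ / ds^*μ = D`. -/
def HasModularFunction (μ : Measure (unitSpace G)) [IsFiniteMeasure μ] (D : G → ℝ) : Prop :=
  rStar μ = (sStar μ).withDensity fun γ => ENNReal.ofReal (D γ)

/-- `ω = ω_μ`, the functional on `C*(G)` determined by `ω_μ(f) = ∫_{G⁽⁰⁾} f dμ` for
`f ∈ C_c(G)`. -/
def IsOmega (μ : Measure (unitSpace G)) (ω : GroupoidCStar G →L[ℂ] ℂ) : Prop :=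
  ∀ f : C_c(G, ℂ), ω (toCStar f) = ∫ x : unitSpace G, f x ∂μ

end Measures

end EtaleKMS

open EtaleKMS

namespace EtaleKMS

open ArrowGroupoid EtaleGroupoid

universe u

/-! ### The unit space of an étale groupoid -/

section Units

variable {G : Type u} [TopologicalSpace G] [EtaleGroupoid G]

/-! For `f` in `C_c(G)` the orbit `t ↦ e^{itc} f` extends to the entire function `z ↦ e^{izc} f`, so
the KMS condition becomes the concrete identity `ω(g * (e^{-βc} f)) = ω(f * g)`
(`IsKMSState.apply_conv`). Everything else follows from good choices of `f` and `g`.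

The state sees only the unit space (`IsKMSState.apply_eq_zero_of_unitSpace`). The unit space is
clopen, so by a partition of unity it suffices to treat functions supported near a single arrow `γ`
that is not a unit. If `c γ ≠ 0`, taking a local unit for `g` shows that `ω` is invariant under
multiplication by `m = e^{-βc}`; when `β = 0` the assumed invariance supplies `m = e^{itc}` with
small `t` instead. Since `m ≠ 1` on the support, `f = m h - h` with `h = f / (m - 1)`, so `ω(f) =
0`. If `c γ = 0`, principality of `c⁻¹(0)` gives `r γ ≠ s γ`, and a cut-off `u` on the units that is
`1` near `r γ` and `0` near `s γ` gives `ω(f) = ω(u * f) = ω(f * u) = 0`.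

Hence `ω` is determined by a positive functional on `C_c(G⁽⁰⁾)`, and the Riesz theorem provides `μ`.
Its mass is at most one because the `I`-norm is the supremum norm on functions supported in the
units, and at least one by Cauchy–Schwarz against local units, since `‖ω‖ = 1`.

For the modular function, let `k = 1` on the support of `f`. On units, `f * k^*` is the sum of `f`
over range fibres and `k^* * (e^{-βc} f)` is the sum of `e^{-βc} f` over source fibres. The KMS
identity therefore says that `r^*μ` and `e^{-βc} s^*μ` agree on `C_c(G)`. These measures coincide
once the second is known to be regular (`regular_withDensity`). -/

theorem s_eq_self_of_r_eq_self {a : G} (h : r a = a) : s a = a := by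
  rw [← h, s_r]

theorem inv_eq_self_of_r_eq_self {a : G} (h : r a = a) : a⁻¹ = a := by
  have h1 := mul_s_self a⁻¹
  rw [s_inv, h] at h1
  rw [← h1, inv_mul_self', s_eq_self_of_r_eq_self h]

theorem inv_mul_cancel_left' {a b : G} (h : r a = r b) : a * (a⁻¹ * b) = b := by
  rw [← mul_assoc' _ _ _ (by rw [r_inv]) (by rw [s_inv, h]), mul_inv', h, r_mul_self]

theorem r_inv_mul {a b : G} (h : r a = r b) : r (a⁻¹ * b) = s a := by
  rw [r_mul _ _ (by rw [s_inv, h]), r_inv]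

theorem mem_unitSpace {a : G} : a ∈ unitSpace G ↔ r a = a := Iff.rfl

theorem r_mem_unitSpace (a : G) : r a ∈ unitSpace G := r_r a

theorem s_mem_unitSpace (a : G) : s a ∈ unitSpace G := r_s a

theorem rMap_coe (x : unitSpace G) : rMap G (x : G) = x := Subtype.ext x.2

variable (G) in
-- Near a unit `x`, both `y` and `r y` lie in a neighbourhood on which the range map is injective,
-- and they have the same range.
theorem isOpen_unitSpace : IsOpen (unitSpace G) := by
  rw [isOpen_iff_mem_nhds]
  intro x hx
  obtain ⟨e, he, hre⟩ := isLocalHomeomorph_rMap (G := G) x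
  have h1 : e.source ∈ 𝓝 x := e.open_source.mem_nhds he
  have h2 : r ⁻¹' e.source ∈ 𝓝 x :=
    continuous_r.continuousAt.preimage_mem_nhds (by rw [mem_unitSpace.1 hx]; exact h1)
  filter_upwards [h1, h2] with y hy1 hy2
  refine e.injOn hy2 hy1 ?_
  rw [← hre]
  exact Subtype.ext (r_r y)

variable (G) in
theorem isClosed_unitSpace [T2Space G] : IsClosed (unitSpace G) :=
  isClosed_eq continuous_r continuous_id

variable (G) in
theorem isClopen_unitSpace [T2Space G] : IsClopen (unitSpace G) :=
  ⟨isClosed_unitSpace G, isOpen_unitSpace G⟩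

end Units

/-! ### Convolution with functions on the units, and convolutions evaluated at units -/

section Convolution

theorem fibreSum_eq_single {G X E : Type*} [AddCommMonoid E] {p : G → X} {f : G → E} {x : X}
    (a : G) (ha : p a = x) (h : ∀ b, p b = x → b ≠ a → f b = 0) : fibreSum p f x = f a := by
  classical
  unfold fibreSum
  rw [finsum_eq_single _ a, finsum_eq_if, if_pos (show a ∈ p ⁻¹' {x} from ha)]
  intro b hb
  rw [finsum_eq_if]
  split_ifs with hbx
  · exact h b hbx hb
  · rfl

variable {G : Type u} [TopologicalSpace G] [EtaleGroupoid G] [T2Space G]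

theorem conv_apply (f g : C_c(G, ℂ)) (γ : G) :
    conv f g γ = fibreSum (rMap G) (fun α => f α * g (α⁻¹ * γ)) (rMap G γ) := rfl

theorem invol_apply (f : C_c(G, ℂ)) (γ : G) : invol f γ = star (f γ⁻¹) := rfl

/-- Only one term of the convolution survives: a unit `b` with `r b = r γ` must be `r γ`. -/
theorem conv_apply_of_left {u : C_c(G, ℂ)} (hu : ∀ γ ∉ unitSpace G, u γ = 0) (f : C_c(G, ℂ))
    (γ : G) : conv u f γ = u (r γ) * f γ := by
  rw [conv_apply, fibreSum_eq_single (r γ) (rMap_coe (rMap G γ))]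
  · rw [inv_eq_self_of_r_eq_self (r_r γ), r_mul_self]
  · intro b hb hne
    have hb' : r b = r γ := congrArg Subtype.val hb
    rw [hu b (fun h => hne (h.symm.trans hb')), zero_mul]

theorem conv_apply_of_right {u : C_c(G, ℂ)} (hu : ∀ γ ∉ unitSpace G, u γ = 0) (f : C_c(G, ℂ))
    (γ : G) : conv f u γ = f γ * u (s γ) := by
  rw [conv_apply, fibreSum_eq_single γ rfl, inv_mul_self']
  intro b hb hne
  have hb' : r b = r γ := congrArg Subtype.val hb
  rw [hu (b⁻¹ * γ), mul_zero]
  intro h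
  have h1 : b⁻¹ * γ = s b := (mem_unitSpace.1 h).symm.trans (r_inv_mul hb')
  apply hne
  rw [← inv_mul_cancel_left' hb', h1, mul_s_self]

/-- With `k = 1` on the support of `f` this is the fibre sum that defines `r^*μ`; `invol_conv_apply`
is the counterpart for `s^*μ`. -/
theorem conv_invol_apply (f k : C_c(G, ℂ)) (x : unitSpace G) :
    conv f (invol k) x = fibreSum (rMap G) (fun γ => f γ * star (k γ)) x := by
  rw [conv_apply, rMap_coe]
  refine finsum_congr fun α => finsum_congr fun hα => ?_
  have hα' : r α = x := congrArg Subtype.val hα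
  have h : α⁻¹ * (x : G) = α⁻¹ := by
    have := mul_s_self α⁻¹
    rwa [s_inv, hα'] at this
  beta_reduce
  rw [invol_apply, h, inv_inv']

theorem invol_conv_apply (k g : C_c(G, ℂ)) (x : unitSpace G) :
    conv (invol k) g x = fibreSum (sMap G) (fun γ => star (k γ) * g γ) x := by
  rw [conv_apply, rMap_coe]
  -- Inversion carries the range fibre over `x` onto the source fibre.
  refine finsum_mem_eq_of_bijOn (fun γ => γ⁻¹) ⟨?_, ?_, ?_⟩ ?_
  · intro α hα
    refine Subtype.ext ?_
    change s α⁻¹ = x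
    rw [s_inv]
    exact congrArg Subtype.val hα
  · intro a _ b _ hab
    simpa only [inv_inv'] using congrArg (fun γ : G => γ⁻¹) hab
  · intro α hα
    refine ⟨α⁻¹, Subtype.ext ?_, inv_inv' α⟩
    change r α⁻¹ = x
    rw [r_inv]
    exact congrArg Subtype.val hα
  · intro α hα
    have hα' : r α = x := congrArg Subtype.val hα
    have h : α⁻¹ * (x : G) = α⁻¹ := by
      have := mul_s_self α⁻¹
      rwa [s_inv, hα'] at this
    rw [invol_apply, h]

/-- The pointwise product of a continuous function with an element of `C_c(G)`. -/
noncomputable def mulCc {G : Type*} [TopologicalSpace G] (m : C(G, ℂ)) (f : C_c(G, ℂ)) :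
    C_c(G, ℂ) where
  toFun γ := m γ * f γ
  continuous_toFun := m.continuous.mul f.continuous
  hasCompactSupport' := f.hasCompactSupport.mul_left

@[simp]
theorem mulCc_apply {G : Type*} [TopologicalSpace G] (m : C(G, ℂ)) (f : C_c(G, ℂ)) (γ : G) :
    mulCc m f γ = m γ * f γ := rfl

theorem tsupport_mulCc_subset {G : Type*} [TopologicalSpace G] (m : C(G, ℂ)) (f : C_c(G, ℂ)) :
    tsupport (mulCc m f) ⊆ tsupport m ∩ tsupport f :=
  Set.subset_inter (closure_mono fun _ h => left_ne_zero_of_mul h)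
    (closure_mono fun _ h => right_ne_zero_of_mul h)

/-- A compactly supported Urysohn function, with complex values. -/
theorem exists_cc_eq_one {X : Type*} [TopologicalSpace X] [T2Space X] [LocallyCompactSpace X]
    {K V : Set X} (hK : IsCompact K) (hV : IsOpen V) (hKV : K ⊆ V) :
    ∃ u : C_c(X, ℂ), (∀ x ∈ K, u x = 1) ∧ (∀ x ∉ V, u x = 0) ∧
      ∀ x, ∃ t : ℝ, u x = t ∧ 0 ≤ t ∧ t ≤ 1 := by
  obtain ⟨f, h1, h2, h3, h4⟩ := exists_continuousMap_one_of_isCompact_subset_isOpen hK hV hKV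
  refine ⟨⟨⟨fun x => (f x : ℂ), by fun_prop⟩, ?_⟩, ?_, ?_, ?_⟩
  · exact (show HasCompactSupport f from h2).comp_left (g := fun t : ℝ => (t : ℂ)) (by simp)
  · intro x hx
    change ((f x : ℝ) : ℂ) = 1
    rw [h1 hx]; simp
  · intro x hx
    change ((f x : ℝ) : ℂ) = 0
    rw [image_eq_zero_of_notMem_tsupport fun h => hx (h3 h)]; simp
  · exact fun x => ⟨f x, rfl, h4 x⟩

end Convolution

/-! ### Estimates for the `I`-norm -/

section INorm

variable {G : Type u} [TopologicalSpace G] [EtaleGroupoid G] [T2Space G]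

theorem fibreSum_norm_nonneg {X : Type*} (p : G → X) (f : C_c(G, ℂ)) (x : X) :
    0 ≤ fibreSum p (fun γ => ‖f γ‖) x :=
  finsum_nonneg fun _ => finsum_nonneg fun _ => norm_nonneg _

theorem INorm_nonneg (f : C_c(G, ℂ)) : 0 ≤ INorm f :=
  le_max_of_le_left (Real.iSup_nonneg fun x => fibreSum_norm_nonneg _ f x)

theorem fibreSum_norm_le_of_le {p : G → unitSpace G} (hp : IsLocalHomeomorph p)
    {f g : C_c(G, ℂ)} {C : ℝ} (h : ∀ γ, ‖f γ‖ ≤ C * ‖g γ‖) (x : unitSpace G) :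
    fibreSum p (fun γ => ‖f γ‖) x ≤ C * fibreSum p (fun γ => ‖g γ‖) x := by
  have hfin := finite_fibre_support hp g x
  have hsum : ∀ k : C_c(G, ℂ), (∀ γ, g γ = 0 → k γ = 0) →
      fibreSum p (fun γ => ‖k γ‖) x = ∑ γ ∈ hfin.toFinset, ‖k γ‖ := by
    intro k hk
    refine finsum_mem_eq_sum_of_inter_support_eq _ ?_
    ext γ
    simp only [Set.mem_inter_iff, Function.mem_support, Set.Finite.coe_toFinset]
    constructor
    · exact fun ⟨h1, h2⟩ => ⟨⟨h1, fun h3 => h2 (by simp [hk γ h3])⟩, h2⟩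
    · exact fun ⟨h1, h2⟩ => ⟨h1.1, h2⟩
  rw [hsum g fun _ h => h, hsum f fun γ h3 => by simpa [h3] using h γ, Finset.mul_sum]
  exact Finset.sum_le_sum fun γ _ => h γ

/-- This turns pointwise estimates of functions into norm estimates in `C*(G)`, through
`norm_toCStar_le`. -/
theorem INorm_le_of_le {f g : C_c(G, ℂ)} {C : ℝ} (hC : 0 ≤ C)
    (h : ∀ γ, ‖f γ‖ ≤ C * ‖g γ‖) : INorm f ≤ C * INorm g := by
  have key : ∀ {p : G → unitSpace G}, IsLocalHomeomorph p →
      ⨆ x, fibreSum p (fun γ => ‖f γ‖) x ≤ C * ⨆ x, fibreSum p (fun γ => ‖g γ‖) x := by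
    intro p hp
    refine Real.iSup_le (fun x => ?_) (mul_nonneg hC
      (Real.iSup_nonneg fun x => fibreSum_norm_nonneg _ g x))
    exact (fibreSum_norm_le_of_le hp h x).trans
      (mul_le_mul_of_nonneg_left (le_ciSup (bddAbove_fibreSum hp g) x) hC)
  refine max_le ((key isLocalHomeomorph_rMap).trans ?_) ((key isLocalHomeomorph_sMap).trans ?_)
  · exact mul_le_mul_of_nonneg_left (le_max_left _ _) hC
  · exact mul_le_mul_of_nonneg_left (le_max_right _ _) hC

theorem norm_toCStar_le (f : C_c(G, ℂ)) : ‖toCStar f‖ ≤ INorm f :=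
  RepProduct.norm_le (INorm_nonneg f) fun π => π.norm_le f

/-- The `I`-norm of a function supported in the unit space is its supremum norm. -/
theorem INorm_le_one_of_support {f : C_c(G, ℂ)} (hf : ∀ γ ∉ unitSpace G, f γ = 0)
    (h1 : ∀ γ, ‖f γ‖ ≤ 1) : INorm f ≤ 1 := by
  have key : ∀ {p : G → unitSpace G}, (∀ x : unitSpace G, p x = x) →
      ⨆ x, fibreSum p (fun γ => ‖f γ‖) x ≤ 1 := by
    intro p hp
    refine Real.iSup_le (fun x => ?_) zero_le_one
    rw [fibreSum_eq_single (x : G) (hp x)]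
    · exact h1 x
    · intro b hb hne
      rw [hf b, norm_zero]
      intro h
      exact hne (congrArg Subtype.val ((hp ⟨b, h⟩).symm.trans hb))
  exact max_le (key rMap_coe) (key fun x => Subtype.ext (s_eq_self_of_r_eq_self x.2))

end INorm

/-! ### Entire elements, and vanishing of KMS states off the unit space -/

section Analytic

variable {G : Type u} [TopologicalSpace G] [EtaleGroupoid G]

/-- The function `e^{izc}` for complex `z`. -/
noncomputable def RealCocycle.expI (c : RealCocycle G) (z : ℂ) : C(G, ℂ) where
  toFun γ := Complex.exp (Complex.I * z * c γ)
  continuous_toFun := by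
    have := c.continuous_toFun
    fun_prop

theorem RealCocycle.expI_apply (c : RealCocycle G) (z : ℂ) (γ : G) :
    c.expI z γ = Complex.exp (Complex.I * z * c γ) := rfl

theorem RealCocycle.expI_I_mul (c : RealCocycle G) (β : ℝ) (γ : G) :
    c.expI (Complex.I * β) γ = (Real.exp (-β * c γ) : ℝ) := by
  rw [RealCocycle.expI_apply, ← mul_assoc, Complex.I_mul_I]
  push_cast
  ring_nf

/-- The cocycle itself, as a complex-valued continuous function. -/
noncomputable def RealCocycle.toComplex (c : RealCocycle G) : C(G, ℂ) where
  toFun γ := c γ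
  continuous_toFun := Complex.continuous_ofReal.comp c.continuous_toFun

theorem RealCocycle.eq_zero_of_mem_unitSpace (c : RealCocycle G) {γ : G}
    (hγ : γ ∈ unitSpace G) : c γ = 0 := by
  rw [← mem_unitSpace.1 hγ, c.map_r]

theorem RealCocycle.exists_bound (c : RealCocycle G) (f : C_c(G, ℂ)) :
    ∃ M : ℝ, 0 < M ∧ ∀ γ, f γ ≠ 0 → |c γ| ≤ M := by
  obtain ⟨M, hM⟩ := f.hasCompactSupport.isCompact.exists_bound_of_continuousOn
    c.continuous_toFun.continuousOn
  exact ⟨max M 1, by positivity,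
    fun γ hγ => (hM γ (subset_tsupport _ hγ)).trans (le_max_left _ _)⟩

variable [T2Space G]

/-- The cocycle is bounded by some `M` where `f ≠ 0`, so the first-order Taylor remainder of
`e^{ihc}` is at most `M² |h|²` there, uniformly in the arrow. The `I`-norm transfers this bound to
`C*(G)`. -/
theorem hasDerivAt_toCStar_expI (c : RealCocycle G) (f : C_c(G, ℂ)) (z : ℂ) :
    HasDerivAt (fun z => toCStar (mulCc (c.expI z) f))
      (toCStar (Complex.I • mulCc c.toComplex (mulCc (c.expI z) f))) z := by
  obtain ⟨M, hM0, hM⟩ := c.exists_bound f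
  rw [hasDerivAt_iff_isLittleO_nhds_zero]
  have hO : (fun h : ℂ => toCStar (mulCc (c.expI (z + h)) f) - toCStar (mulCc (c.expI z) f) -
      h • toCStar (Complex.I • mulCc c.toComplex (mulCc (c.expI z) f))) =O[𝓝 0]
      fun h : ℂ => h ^ 2 := by
    refine Asymptotics.IsBigO.of_bound (M ^ 2 * INorm (mulCc (c.expI z) f)) ?_
    -- This radius gives `|h c| ≤ 1` where `f ≠ 0`, the range in which `|e^w - 1 - w| ≤ |w|²` is
    -- applied.
    have hball : ∀ᶠ h : ℂ in 𝓝 0, ‖h‖ < 1 / M := by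
      filter_upwards [Metric.ball_mem_nhds (0 : ℂ) (show (0 : ℝ) < 1 / M by positivity)] with h hh
      simpa using hh
    filter_upwards [hball] with h hh
    rw [← map_sub, ← map_smul, ← map_sub]
    refine (norm_toCStar_le _).trans ?_
    rw [norm_pow, mul_right_comm]
    refine INorm_le_of_le (by positivity) fun γ => ?_
    change ‖c.expI (z + h) γ * f γ - c.expI z γ * f γ -
      h * (Complex.I * ((c γ : ℂ) * (c.expI z γ * f γ)))‖ ≤ _ * ‖c.expI z γ * f γ‖
    by_cases hf : f γ = 0
    · simp [hf]
    have hle := hM γ hf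
    have hnorm : ‖Complex.I * h * c γ‖ = ‖h‖ * |c γ| := by simp
    have hexp : c.expI (z + h) γ = Complex.exp (Complex.I * h * c γ) * c.expI z γ := by
      rw [RealCocycle.expI_apply, RealCocycle.expI_apply, ← Complex.exp_add]
      ring_nf
    have h1 : ‖Complex.I * h * c γ‖ ≤ 1 := by
      rw [hnorm]
      calc ‖h‖ * |c γ| ≤ 1 / M * M := by gcongr
        _ = 1 := by field_simp
    have h2 := Complex.norm_exp_sub_one_sub_id_le h1
    have h3 : c.expI (z + h) γ * f γ - c.expI z γ * f γ -
        h * (Complex.I * ((c γ : ℂ) * (c.expI z γ * f γ))) =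
        (Complex.exp (Complex.I * h * c γ) - 1 - Complex.I * h * c γ) * (c.expI z γ * f γ) := by
      rw [hexp]; ring
    rw [h3, norm_mul]
    gcongr
    refine h2.trans ?_
    rw [hnorm, mul_pow, mul_comm]
    gcongr
  refine hO.trans_isLittleO ?_
  simpa using Asymptotics.isLittleO_pow_pow (𝕜 := ℂ) (show 1 < 2 by norm_num)

theorem isEntireExtension_toCStar (c : RealCocycle G) (f : C_c(G, ℂ)) :
    IsEntireExtension (cocycleAction c) (toCStar f) fun z => toCStar (mulCc (c.expI z) f) :=
  ⟨fun z => (hasDerivAt_toCStar_expI c f z).differentiableAt, fun _ => rfl⟩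

/-- The KMS condition on `C_c(G)`. -/
theorem IsKMSState.apply_conv {c : RealCocycle G} {β : ℝ} {ω : GroupoidCStar G →L[ℂ] ℂ}
    (hω : IsKMSState (cocycleAction c) β ω) (f g : C_c(G, ℂ)) :
    ω (toCStar (conv g (mulCc (c.expI (Complex.I * β)) f))) = ω (toCStar (conv f g)) := by
  rw [toCStar_conv, toCStar_conv]
  exact hω.kms _ _ _ (isEntireExtension_toCStar c f)

variable [LocallyCompactSpace G]

/-- Local units: a cut-off function on the unit space that equals `1` on a given compact set. -/
theorem exists_unit_cutoff {K V : Set G} (hK : IsCompact K) (hKu : K ⊆ unitSpace G)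
    (hV : IsOpen V) (hKV : K ⊆ V) :
    ∃ u : C_c(G, ℂ), (∀ x ∈ K, u x = 1) ∧ (∀ x ∉ unitSpace G, u x = 0) ∧ (∀ x ∉ V, u x = 0) ∧
      ∀ x, ∃ t : ℝ, u x = t ∧ 0 ≤ t ∧ t ≤ 1 := by
  obtain ⟨u, h1, h2, h3⟩ := exists_cc_eq_one hK ((isOpen_unitSpace G).inter hV)
    (Set.subset_inter hKu hKV)
  exact ⟨u, h1, fun x hx => h2 x fun h => hx h.1, fun x hx => h2 x fun h => hx h.2, h3⟩

/-- The cut-off equals `1` on the ranges and sources of the support of `f`. Quantifying over `g`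
lets the same `u` serve both `f` and `e^{-βc} f`. -/
theorem exists_local_unit (f : C_c(G, ℂ)) :
    ∃ u : C_c(G, ℂ), (∀ x ∉ unitSpace G, u x = 0) ∧
      (∀ x, ∃ t : ℝ, u x = t ∧ 0 ≤ t ∧ t ≤ 1) ∧
      ∀ g : C_c(G, ℂ), (∀ γ, f γ = 0 → g γ = 0) → conv u g = g ∧ conv g u = g := by
  have hK : IsCompact (r '' tsupport f ∪ s '' tsupport f) :=
    (f.hasCompactSupport.isCompact.image continuous_r).union
      (f.hasCompactSupport.isCompact.image continuous_s)
  obtain ⟨u, h1, h2, -, h3⟩ := exists_unit_cutoff hK (V := Set.univ)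
    (by rintro _ (⟨γ, _, rfl⟩ | ⟨γ, _, rfl⟩); exacts [r_mem_unitSpace γ, s_mem_unitSpace γ])
    isOpen_univ (Set.subset_univ _)
  refine ⟨u, h2, h3, fun g hg => ⟨?_, ?_⟩⟩
  · ext γ
    rw [conv_apply_of_left h2]
    by_cases h : f γ = 0
    · rw [hg γ h, mul_zero]
    · rw [h1 _ (Or.inl ⟨γ, subset_tsupport _ h, rfl⟩), one_mul]
  · ext γ
    rw [conv_apply_of_right h2]
    by_cases h : f γ = 0
    · rw [hg γ h, zero_mul]
    · rw [h1 _ (Or.inr ⟨γ, subset_tsupport _ h, rfl⟩), mul_one]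

/-- This is the KMS identity for `f` against a local unit, which disappears from both products. -/
theorem IsKMSState.apply_expI {c : RealCocycle G} {β : ℝ} {ω : GroupoidCStar G →L[ℂ] ℂ}
    (hω : IsKMSState (cocycleAction c) β ω) (f : C_c(G, ℂ)) :
    ω (toCStar (mulCc (c.expI (Complex.I * β)) f)) = ω (toCStar f) := by
  obtain ⟨u, -, -, hu⟩ := exists_local_unit f
  have h := hω.apply_conv f u
  rwa [(hu f fun _ h => h).2, (hu (mulCc _ f) fun γ h => by simp [h]).1] at h

/-- A functional invariant under multiplication by `m` vanishes on functions supported where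
`m ≠ 1`. -/
theorem apply_eq_zero_of_invariant {ω : GroupoidCStar G →L[ℂ] ℂ} {m : C(G, ℂ)}
    (hm : ∀ f, ω (toCStar (mulCc m f)) = ω (toCStar f)) (f : C_c(G, ℂ))
    (hf : ∀ γ ∈ tsupport f, m γ ≠ 1) : ω (toCStar f) = 0 := by
  -- The quotient `f / (m - 1)` is continuous: the denominator is nonzero on the closed support of
  -- `f`, and off it the quotient is locally zero.
  let g : C_c(G, ℂ) :=
    { toFun := fun γ => (m γ - 1)⁻¹ * f γ
      continuous_toFun := by
        rw [continuous_iff_continuousAt]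
        intro γ
        by_cases hγ : γ ∈ tsupport f
        · exact ((m.continuous.sub continuous_const).continuousAt.inv₀
            (sub_ne_zero.2 (hf γ hγ))).mul f.continuous.continuousAt
        · have h0 : (fun γ => (m γ - 1)⁻¹ * f γ) =ᶠ[𝓝 γ] fun _ => 0 := by
            filter_upwards [(isClosed_tsupport f).isOpen_compl.mem_nhds hγ] with y hy
            rw [image_eq_zero_of_notMem_tsupport hy, mul_zero]
          exact continuousAt_const.congr h0.symm
      hasCompactSupport' := f.hasCompactSupport.mul_left }
  have hfg : f = mulCc m g - g := by
    ext γ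
    change f γ = m γ * ((m γ - 1)⁻¹ * f γ) - (m γ - 1)⁻¹ * f γ
    by_cases hγ : f γ = 0
    · simp [hγ]
    · have := sub_ne_zero.2 (hf γ (subset_tsupport _ hγ))
      field_simp
  rw [hfg, map_sub, map_sub, hm, sub_self]

/-- A KMS state vanishes on functions supported where the cocycle does not vanish. -/
theorem IsKMSState.apply_eq_zero_of_cocycle_ne_zero {c : RealCocycle G} {β : ℝ}
    {ω : GroupoidCStar G →L[ℂ] ℂ} (hω : IsKMSState (cocycleAction c) β ω)
    (hβ : β = 0 → ∀ (t : ℝ) (a : GroupoidCStar G), ω (cocycleAction c t a) = ω a)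
    (f : C_c(G, ℂ)) (hf : ∀ γ ∈ tsupport f, c γ ≠ 0) : ω (toCStar f) = 0 := by
  by_cases hb : β = 0
  · obtain ⟨M, hM⟩ := f.hasCompactSupport.isCompact.exists_bound_of_continuousOn
      c.continuous_toFun.continuousOn
    have hM' : ∀ γ ∈ tsupport f, |c γ| ≤ max M 1 := fun γ hγ => (hM γ hγ).trans (le_max_left _ _)
    have hpos : (0 : ℝ) < max M 1 := by positivity
    -- For `β = 0` the factor `e^{-βc}` is trivial, so `e^{itc}` is used. The time `t = 1 / max M 1`
    -- keeps `|t c| ≤ 1 < 2π` on the support, so `e^{itc} = 1` there only where `c = 0`.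
    refine apply_eq_zero_of_invariant (m := c.expI ((1 / max M 1 : ℝ) : ℂ))
      (fun g => hβ hb _ (toCStar g)) f fun γ hγ h => ?_
    rw [RealCocycle.expI_apply, Complex.exp_eq_one_iff] at h
    obtain ⟨n, hn⟩ := h
    have hn' : 1 / max M 1 * c γ = n * (2 * Real.pi) := by
      have : Complex.I * ((1 / max M 1 * c γ : ℝ) : ℂ) =
          Complex.I * ((n * (2 * Real.pi) : ℝ) : ℂ) := by
        push_cast at hn ⊢
        linear_combination hn
      exact_mod_cast mul_left_cancel₀ Complex.I_ne_zero this
    have habs : |1 / max M 1 * c γ| ≤ 1 := by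
      rw [abs_mul, abs_of_pos (by positivity)]
      calc 1 / max M 1 * |c γ| ≤ 1 / max M 1 * max M 1 := by gcongr; exact hM' γ hγ
        _ = 1 := by field_simp
    have hn0 : n = 0 := by
      by_contra hne
      have h1 : (1 : ℝ) ≤ |(n : ℝ)| := by exact_mod_cast Int.one_le_abs hne
      rw [hn', abs_mul, abs_of_pos Real.two_pi_pos] at habs
      nlinarith [Real.pi_gt_three]
    rw [hn0, Int.cast_zero, zero_mul, mul_eq_zero] at hn'
    exact hn'.elim (by positivity) (hf γ hγ)
  · refine apply_eq_zero_of_invariant hω.apply_expI f fun γ hγ h => ?_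
    rw [c.expI_I_mul, Complex.ofReal_eq_one, Real.exp_eq_one_iff] at h
    exact (mul_ne_zero (neg_ne_zero.2 hb) (hf γ hγ)) h

/-- A KMS state vanishes on functions supported near an arrow with distinct range and source. -/
theorem IsKMSState.apply_eq_zero_of_disjoint {c : RealCocycle G} {β : ℝ}
    {ω : GroupoidCStar G →L[ℂ] ℂ} (hω : IsKMSState (cocycleAction c) β ω)
    (f : C_c(G, ℂ)) (hf : Disjoint (r '' tsupport f) (s '' tsupport f)) :
    ω (toCStar f) = 0 := by
  -- The cut-off is `1` on the ranges and `0` on the sources, so `u * f = f` and `f * u = 0`. It is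
  -- fixed by `α_{iβ}` because `c` vanishes on units, so the KMS identity equates `ω(f)` with
  -- `ω(0)`.
  obtain ⟨u, h1, h2, h3, -⟩ := exists_unit_cutoff
    (f.hasCompactSupport.isCompact.image continuous_r)
    (by rintro _ ⟨γ, _, rfl⟩; exact r_mem_unitSpace γ)
    (f.hasCompactSupport.isCompact.image continuous_s).isClosed.isOpen_compl
    hf.subset_compl_right
  have hu : mulCc (c.expI (Complex.I * β)) u = u := by
    ext γ
    rw [mulCc_apply]
    by_cases hγ : γ ∈ unitSpace G
    · rw [c.expI_I_mul, c.eq_zero_of_mem_unitSpace hγ]; simp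
    · rw [h2 γ hγ, mul_zero]
  have huf : conv u f = f := by
    ext γ
    rw [conv_apply_of_left h2]
    by_cases hγ : f γ = 0
    · rw [hγ, mul_zero]
    · rw [h1 _ ⟨γ, subset_tsupport _ hγ, rfl⟩, one_mul]
  have hfu : conv f u = 0 := by
    ext γ
    rw [conv_apply_of_right h2]
    by_cases hγ : f γ = 0
    · rw [hγ, zero_mul]; rfl
    · rw [h3 _ fun h => h ⟨γ, subset_tsupport _ hγ, rfl⟩, mul_zero]; rfl
  have h := hω.apply_conv u f
  rwa [hu, huf, hfu, map_zero, map_zero, eq_comm] at h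

/-- A linear functional on `C_c(X)` that vanishes locally near the support of `f` vanishes
at `f`. -/
theorem apply_eq_zero_of_locally {X : Type*} [TopologicalSpace X] [T2Space X]
    [LocallyCompactSpace X] (φ : C_c(X, ℂ) →ₗ[ℂ] ℂ) (f : C_c(X, ℂ))
    (h : ∀ x ∈ tsupport f, ∃ U, IsOpen U ∧ x ∈ U ∧
      ∀ g : C_c(X, ℂ), tsupport g ⊆ U → φ g = 0) : φ f = 0 := by
  choose! U hUo hxU hU using h
  obtain ⟨t, htf, ht⟩ := f.hasCompactSupport.isCompact.elim_nhds_subcover U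
    fun x hx => (hUo x hx).mem_nhds (hxU x hx)
  let e := t.equivFin
  obtain ⟨p, hp1, hp2, -, -⟩ := exists_continuous_sum_one_of_isOpen_isCompact
    (s := fun i => U (e.symm i)) (fun i => hUo _ (htf _ (e.symm i).2))
    f.hasCompactSupport.isCompact (fun x hx => by
      obtain ⟨y, hy, hxy⟩ := Set.mem_iUnion₂.1 (ht hx)
      exact Set.mem_iUnion.2 ⟨e ⟨y, hy⟩, by simpa using hxy⟩)
  let q : Fin t.card → C(X, ℂ) := fun i => ⟨fun x => (p i x : ℂ), by fun_prop⟩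
  have hq : ∀ i, tsupport (q i) ⊆ U (e.symm i) := fun i =>
    (closure_mono (s := Function.support (q i)) (t := Function.support (p i))
      fun x hx h0 => hx (by
        change ((p i x : ℝ) : ℂ) = 0
        rw [h0, Complex.ofReal_zero])).trans (hp1 i)
  have hsum : f = ∑ i, mulCc (q i) f := by
    ext x
    rw [CompactlySupportedContinuousMap.sum_apply]
    simp only [mulCc_apply]
    rw [← Finset.sum_mul]
    by_cases hx : f x = 0
    · simp [hx]
    · have h1 := hp2 (subset_tsupport _ hx)
      have h2 : ∑ i, q i x = 1 := by
        change ∑ i, ((p i x : ℝ) : ℂ) = 1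
        rw [← Complex.ofReal_sum, Complex.ofReal_eq_one]
        simpa using h1
      rw [h2, one_mul]
  rw [hsum, map_sum]
  exact Finset.sum_eq_zero fun i _ => hU _ (htf _ (e.symm i).2) _
    (((tsupport_mulCc_subset _ _).trans Set.inter_subset_left).trans (hq i))

/-- A KMS state vanishes on functions supported off the unit space. -/
theorem IsKMSState.apply_eq_zero_of_unitSpace {c : RealCocycle G}
    (hc : IsPrincipal {γ : G | c γ = 0}) {β : ℝ} {ω : GroupoidCStar G →L[ℂ] ℂ}
    (hω : IsKMSState (cocycleAction c) β ω)
    (hβ : β = 0 → ∀ (t : ℝ) (a : GroupoidCStar G), ω (cocycleAction c t a) = ω a)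
    (f : C_c(G, ℂ)) (hf : ∀ γ ∈ unitSpace G, f γ = 0) : ω (toCStar f) = 0 := by
  refine apply_eq_zero_of_locally (ω.toLinearMap ∘ₗ toCStar) f fun γ hγ => ?_
  have hγu : γ ∉ unitSpace G := by
    have : tsupport f ⊆ (unitSpace G)ᶜ :=
      closure_minimal (fun y hy hyu => hy (hf y hyu)) (isOpen_unitSpace G).isClosed_compl
    exact this hγ
  by_cases hcγ : c γ = 0
  -- If `r γ = s γ`, then `γ` and the unit `r γ` are elements of `c⁻¹(0)` with equal range and
  -- source, so principality makes `γ` a unit.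
  · have hne : r γ ≠ s γ := fun h => hγu <| mem_unitSpace.2 <|
      hc (c.map_r γ) hcγ (Prod.ext (r_r γ) ((s_r γ).trans h))
    obtain ⟨A, B, hA, hB, hrA, hsB, hAB⟩ := t2_separation hne
    refine ⟨r ⁻¹' A ∩ s ⁻¹' B, (hA.preimage continuous_r).inter (hB.preimage continuous_s),
      ⟨hrA, hsB⟩, fun g hg => hω.apply_eq_zero_of_disjoint g (hAB.mono ?_ ?_)⟩
    · rintro _ ⟨y, hy, rfl⟩; exact (hg hy).1
    · rintro _ ⟨y, hy, rfl⟩; exact (hg hy).2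
  · exact ⟨{y | c y ≠ 0}, isOpen_ne_fun c.continuous_toFun continuous_const, hcγ,
      fun g hg => hω.apply_eq_zero_of_cocycle_ne_zero hβ g hg⟩

/-- A KMS state only depends on the restriction of functions to the unit space. -/
theorem IsKMSState.apply_congr {c : RealCocycle G}
    (hc : IsPrincipal {γ : G | c γ = 0}) {β : ℝ} {ω : GroupoidCStar G →L[ℂ] ℂ}
    (hω : IsKMSState (cocycleAction c) β ω)
    (hβ : β = 0 → ∀ (t : ℝ) (a : GroupoidCStar G), ω (cocycleAction c t a) = ω a)
    {f g : C_c(G, ℂ)} (h : ∀ x : unitSpace G, f x = g x) : ω (toCStar f) = ω (toCStar g) := by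
  rw [← sub_eq_zero, ← map_sub, ← map_sub]
  exact hω.apply_eq_zero_of_unitSpace hc hβ _ fun γ hγ => sub_eq_zero.2 (h ⟨γ, hγ⟩)

end Analytic

/-! ### Cauchy–Schwarz for states -/

section CauchySchwarz

/-- The Cauchy–Schwarz inequality for a positive functional on a C⋆-algebra. -/
theorem IsState.norm_sq_apply_le {A : Type*} [NonUnitalCStarAlgebra A] {ω : A →L[ℂ] ℂ}
    (hω : IsState ω) (a b : A) :
    ‖ω (star a * b)‖ ^ 2 ≤ ‖ω (star a * a)‖ * ‖ω (star b * b)‖ := by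
  -- In the spectral order the positive elements are exactly the `star b * b`, so `ω` is a positive
  -- map and its pre-GNS semi-inner product is available.
  let _ := CStarAlgebra.spectralOrder A
  have := CStarAlgebra.spectralOrderedRing A
  let φ : A →ₚ[ℂ] ℂ := PositiveLinearMap.mk₀ ω.toLinearMap fun a ha => by
    obtain ⟨b, rfl⟩ := CStarAlgebra.nonneg_iff_eq_star_mul_self.1 ha
    exact hω.nonneg b
  have h := inner_mul_inner_self_le (𝕜 := ℂ) (φ.toPreGNS a) (φ.toPreGNS b)
  rw [norm_inner_symm (φ.toPreGNS b), ← sq] at h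
  exact h.trans (mul_le_mul (RCLike.re_le_norm _) (RCLike.re_le_norm _)
    (inner_self_nonneg (𝕜 := ℂ)) (norm_nonneg _))

end CauchySchwarz

/-! ### Regularity of measures with continuous positive density -/

section WithDensity

open MeasureTheory

variable {X : Type*} [TopologicalSpace X] [T2Space X] [MeasurableSpace X] [BorelSpace X]

/-- A regular measure multiplied by a positive continuous density is regular. -/
theorem regular_withDensity (ν : Measure X) [ν.Regular] {D : X → ℝ} (hD : Continuous D)
    (hpos : ∀ x, 0 < D x) : (ν.withDensity fun x => ENNReal.ofReal (D x)).Regular := by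
  have hmeas : Measurable fun x => ENNReal.ofReal (D x) := by fun_prop
  set κ := ν.withDensity fun x => ENNReal.ofReal (D x) with hκ
  -- On the increasing open sets where `1 / (n + 1) < D < n + 1`, the measures `ν` and `κ` are
  -- comparable up to the factor `n + 1`. They exhaust `X`, so regularity passes from `ν` to `κ`
  -- piecewise, without σ-finiteness of `ν`.
  let s : ℕ → Set X := fun n => {x | D x < n + 1 ∧ 1 < (n + 1) * D x}
  have hso : ∀ n, IsOpen (s n) := fun n =>
    (isOpen_lt hD continuous_const).inter (isOpen_lt continuous_const (continuous_const.mul hD))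
  have hsm : Monotone s := by
    intro m n hmn x hx
    have h1 : (m : ℝ) ≤ n := by exact_mod_cast hmn
    exact ⟨hx.1.trans_le (by linarith),
      hx.2.trans_le (mul_le_mul_of_nonneg_right (by linarith) (hpos x).le)⟩
  have hsu : ⋃ n, s n = Set.univ := by
    refine Set.eq_univ_of_forall fun x => Set.mem_iUnion.2 ?_
    obtain ⟨n, hn⟩ := exists_nat_gt (max (D x) (D x)⁻¹)
    have h1 := (le_max_left _ _).trans_lt hn
    have h2 := (le_max_right _ _).trans_lt hn
    refine ⟨n, by linarith, ?_⟩
    calc 1 = (D x)⁻¹ * D x := (inv_mul_cancel₀ (hpos x).ne').symm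
      _ < (n + 1) * D x := mul_lt_mul_of_pos_right (by linarith) (hpos x)
  have hle : ∀ (n : ℕ) (A : Set X), MeasurableSet A → A ⊆ s n → κ A ≤ (n + 1) * ν A := by
    intro n A hA hAs
    rw [hκ, withDensity_apply _ hA, ← setLIntegral_const]
    refine setLIntegral_mono' hA fun x hx => ?_
    refine (ENNReal.ofReal_le_ofReal (hAs hx).1.le).trans_eq ?_
    rw [ENNReal.ofReal_add (by positivity) zero_le_one, ENNReal.ofReal_natCast, ENNReal.ofReal_one]
  have hge : ∀ (n : ℕ) (A : Set X), MeasurableSet A → A ⊆ s n → ν A ≤ (n + 1) * κ A := by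
    intro n A hA hAs
    rw [hκ, withDensity_apply _ hA, ← lintegral_const_mul _ hmeas, ← setLIntegral_one]
    refine setLIntegral_mono' hA fun x hx => ?_
    have h1 : ((n : ℝ≥0∞) + 1) = ENNReal.ofReal (n + 1) := by
      rw [ENNReal.ofReal_add (by positivity) zero_le_one, ENNReal.ofReal_natCast,
        ENNReal.ofReal_one]
    rw [h1, ← ENNReal.ofReal_mul (by positivity)]
    exact ENNReal.one_le_ofReal.2 (hAs hx).2.le
  have hn0 : ∀ n : ℕ, (n : ℝ≥0∞) + 1 ≠ 0 := fun n => by simp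
  have hnt : ∀ n : ℕ, (n : ℝ≥0∞) + 1 ≠ ∞ := fun n => by simp
  refine { lt_top_of_isCompact := ?_, outerRegular := ?_, innerRegular := ?_ }
  · intro K hK
    obtain ⟨n, hn⟩ := hK.elim_directed_cover s hso (hsu ▸ Set.subset_univ _) hsm.directed_le
    exact (hle n K hK.measurableSet hn).trans_lt
      (ENNReal.mul_lt_top (hnt n).lt_top hK.measure_lt_top)
  · intro A hA ρ hρ
    -- The slack `ρ - κ A` is distributed over the pieces. An excess below `δ n / (n + 1)` for `ν`
    -- costs at most `δ n` for `κ` inside `s n`.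
    obtain ⟨δ, hδ, hδs⟩ := ENNReal.exists_pos_sum_of_countable (tsub_pos_of_lt hρ).ne' ℕ
    have hU : ∀ n, ∃ U, A ∩ s n ⊆ U ∧ IsOpen U ∧
        ν (U \ (A ∩ s n)) < δ n / (n + 1) := by
      intro n
      have hAn : MeasurableSet (A ∩ s n) := hA.inter (hso n).measurableSet
      have hfin : ν (A ∩ s n) ≠ ∞ := by
        refine ((hge n _ hAn Set.inter_subset_right).trans_lt
          (ENNReal.mul_lt_top (hnt n).lt_top ?_)).ne
        exact (measure_mono Set.inter_subset_left).trans_lt (hρ.trans_le le_top)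
      obtain ⟨U, h1, h2, -, h3⟩ := hAn.exists_isOpen_sdiff_lt hfin
        (ENNReal.div_pos (ENNReal.coe_ne_zero.2 (hδ n).ne') (hnt n)).ne'
      exact ⟨U, h1, h2, h3⟩
    choose U hAU hUo hUν using hU
    refine ⟨⋃ n, U n ∩ s n, ?_, isOpen_iUnion fun n => (hUo n).inter (hso n), ?_⟩
    · intro x hx
      obtain ⟨n, hn⟩ := Set.mem_iUnion.1 (hsu ▸ Set.mem_univ x : x ∈ ⋃ n, s n)
      exact Set.mem_iUnion.2 ⟨n, hAU n ⟨hx, hn⟩, hn⟩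
    have hsub : ⋃ n, U n ∩ s n ⊆ A ∪ ⋃ n, (U n \ (A ∩ s n)) ∩ s n := by
      refine Set.iUnion_subset fun n x hx => ?_
      by_cases hxA : x ∈ A
      · exact Or.inl hxA
      · exact Or.inr (Set.mem_iUnion.2 ⟨n, ⟨hx.1, fun h => hxA h.1⟩, hx.2⟩)
    calc κ (⋃ n, U n ∩ s n) ≤ κ A + κ (⋃ n, (U n \ (A ∩ s n)) ∩ s n) :=
          (measure_mono hsub).trans (measure_union_le _ _)
      _ ≤ κ A + ∑' n, (δ n : ℝ≥0∞) := by
          gcongr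
          refine (measure_iUnion_le _).trans (ENNReal.tsum_le_tsum fun n => ?_)
          refine (hle n _ (((hUo n).measurableSet.diff
            (hA.inter (hso n).measurableSet)).inter (hso n).measurableSet)
            Set.inter_subset_right).trans ?_
          calc _ ≤ ((n : ℝ≥0∞) + 1) * (δ n / (n + 1)) := by
                gcongr
                exact (measure_mono Set.inter_subset_left).trans (hUν n).le
            _ = δ n := ENNReal.mul_div_cancel (hn0 n) (hnt n)
      _ < κ A + (ρ - κ A) := by
          rwa [ENNReal.add_lt_add_iff_left (hρ.trans_le le_top).ne]
      _ = ρ := add_tsub_cancel_of_le hρ.le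
  · intro V hV ρ hρ
    have hVs : κ V = ⨆ n, κ (V ∩ s n) := by
      rw [← Monotone.measure_iUnion fun m n h => Set.inter_subset_inter_right V (hsm h),
        ← Set.inter_iUnion, hsu, Set.inter_univ]
    rw [hVs, lt_iSup_iff] at hρ
    obtain ⟨n, hn⟩ := hρ
    have hO : IsOpen (V ∩ s n) := hV.inter (hso n)
    -- If `ν` is infinite on the piece, a compact set of `ν`-measure above `(n + 1) ρ` has
    -- `κ`-measure above `ρ`. Otherwise the piece is approximated from inside up to a small
    -- `ν`-remainder.
    by_cases hfin : ν (V ∩ s n) = ∞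
    · have : (n + 1) * ρ < ν (V ∩ s n) := by
        rw [hfin]
        exact ENNReal.mul_lt_top (hnt n).lt_top (hn.trans_le le_top)
      obtain ⟨K, hKV, hK, hKν⟩ := hO.exists_lt_isCompact this
      refine ⟨K, hKV.trans Set.inter_subset_left, hK, ?_⟩
      have := hKν.trans_le (hge n K hK.measurableSet (hKV.trans Set.inter_subset_right))
      exact lt_of_mul_lt_mul_left' this
    · have hκfin : κ (V ∩ s n) ≠ ∞ := ((hle n _ hO.measurableSet Set.inter_subset_right).trans_lt
        (ENNReal.mul_lt_top (hnt n).lt_top (Ne.lt_top hfin))).ne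
      have hε : (κ (V ∩ s n) - ρ) / (n + 1) ≠ 0 :=
        (ENNReal.div_pos (tsub_pos_of_lt hn).ne' (hnt n)).ne'
      obtain ⟨K, hKV, hK, hKν⟩ := hO.measurableSet.exists_isCompact_sdiff_lt hfin hε
      refine ⟨K, hKV.trans Set.inter_subset_left, hK, ?_⟩
      have h1 : κ ((V ∩ s n) \ K) < κ (V ∩ s n) - ρ := by
        refine (hle n _ (hO.measurableSet.diff hK.measurableSet)
          (Set.sdiff_subset.trans Set.inter_subset_right)).trans_lt ?_
        rw [mul_comm]
        exact ENNReal.mul_lt_of_lt_div hKν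
      have h2 : κ (V ∩ s n) ≤ κ ((V ∩ s n) \ K) + κ K := by
        refine (measure_sdiff_add_inter (V ∩ s n) hK.measurableSet).ge.trans ?_
        gcongr
        exact Set.inter_subset_right
      by_contra! h3
      have h4 : κ (V ∩ s n) < (κ (V ∩ s n) - ρ) + ρ :=
        h2.trans_lt (ENNReal.add_lt_add_of_lt_of_le (h3.trans_lt (hn.trans_le le_top)).ne h1 h3)
      rw [tsub_add_cancel_of_le hn.le] at h4
      exact lt_irrefl _ h4

/-- Two measures with a continuous density between them, compared on `C_c(X)`. -/
theorem eq_withDensity_of_integral_eq [LocallyCompactSpace X] (ν ν' : Measure X) [ν.Regular]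
    [ν'.Regular] {D : X → ℝ} (hD : Continuous D) (hpos : ∀ x, 0 < D x)
    (h : ∀ f : C_c(X, ℝ), ∫ x, f x ∂ν' = ∫ x, D x * f x ∂ν) :
    ν' = ν.withDensity fun x => ENNReal.ofReal (D x) := by
  -- Integrals against `C_c(X)` determine a measure only among regular ones.
  have := regular_withDensity ν hD hpos
  refine Measure.ext_of_integral_eq_on_compactlySupported fun f => ?_
  have h1 := integral_withDensity_eq_integral_toReal_smul (μ := ν)
    (f := fun x => ENNReal.ofReal (D x)) (by fun_prop) (by simp) f
  rw [h f, h1]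
  refine integral_congr_ae (.of_forall fun x => ?_)
  simp [ENNReal.toReal_ofReal (hpos x).le]

end WithDensity

/-! ### The measure on the unit space -/

section UnitMeasure

open MeasureTheory

variable {G : Type u} [TopologicalSpace G] [EtaleGroupoid G] [T2Space G]

/-- Extension by zero from the unit space. -/
noncomputable def extendUnits : C_c(unitSpace G, ℝ) →ₗ[ℝ] C_c(G, ℂ) where
  toFun h :=
    { toFun := (unitSpace G).indicator fun γ => (h (rMap G γ) : ℂ)
      continuous_toFun := by
        have h1 : Continuous fun γ : G => (h (rMap G γ) : ℂ) :=
          Complex.continuous_ofReal.comp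
            (h.continuous.comp isLocalHomeomorph_rMap.continuous)
        exact h1.indicator fun a ha => by simp [(isClopen_unitSpace G).frontier_eq] at ha
      hasCompactSupport' := by
        refine HasCompactSupport.intro
          (h.hasCompactSupport.isCompact.image continuous_subtype_val) fun γ hγ => ?_
        by_cases hu : γ ∈ unitSpace G
        · have h0 : h (rMap G γ) = 0 := image_eq_zero_of_notMem_tsupport
            fun hm => hγ ⟨_, hm, mem_unitSpace.1 hu⟩
          rw [Set.indicator_of_mem hu, h0, Complex.ofReal_zero]
        · rw [Set.indicator_of_notMem hu] }
  map_add' h k := by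
    ext γ
    change (unitSpace G).indicator (fun γ => ((h (rMap G γ) + k (rMap G γ) : ℝ) : ℂ)) γ =
      (unitSpace G).indicator _ γ + (unitSpace G).indicator _ γ
    by_cases hγ : γ ∈ unitSpace G <;> simp [hγ]
  map_smul' a h := by
    ext γ
    change (unitSpace G).indicator (fun γ => ((a * h (rMap G γ) : ℝ) : ℂ)) γ =
      a • (unitSpace G).indicator _ γ
    by_cases hγ : γ ∈ unitSpace G <;> simp [hγ]

theorem extendUnits_apply_coe (h : C_c(unitSpace G, ℝ)) (x : unitSpace G) :
    extendUnits h x = h x := by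
  change (unitSpace G).indicator (fun γ => (h (rMap G γ) : ℂ)) (x : G) = _
  rw [Set.indicator_of_mem x.2, rMap_coe]

theorem extendUnits_apply_of_notMem (h : C_c(unitSpace G, ℝ)) {γ : G} (hγ : γ ∉ unitSpace G) :
    extendUnits h γ = 0 :=
  Set.indicator_of_notMem hγ fun γ => (h (rMap G γ) : ℂ)

theorem norm_extendUnits_le {h : C_c(unitSpace G, ℝ)} {C : ℝ} (hC : 0 ≤ C)
    (hh : ∀ x, |h x| ≤ C) (γ : G) : ‖extendUnits h γ‖ ≤ C := by
  by_cases hγ : γ ∈ unitSpace G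
  · rw [extendUnits_apply_coe h ⟨γ, hγ⟩, Complex.norm_real]
    exact hh _
  · rw [extendUnits_apply_of_notMem h hγ, norm_zero]
    exact hC

/-- The restriction to the unit space, composed with a real-linear functional on `ℂ`. -/
noncomputable def restrictUnits (φ : ℂ →L[ℝ] ℝ) (f : C_c(G, ℂ)) : C_c(unitSpace G, ℝ) where
  toFun x := φ (f x)
  continuous_toFun := φ.continuous.comp (f.continuous.comp continuous_subtype_val)
  hasCompactSupport' := (f.hasCompactSupport.comp_isClosedEmbedding
    (isClosed_unitSpace G).isClosedEmbedding_subtypeVal).comp_left (map_zero φ)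

/-- Products `u* u` of functions supported in the unit space. -/
theorem invol_conv_self_apply {u : C_c(G, ℂ)} (hu : ∀ γ ∉ unitSpace G, u γ = 0) (γ : G) :
    conv (invol u) u γ = star (u γ) * u γ := by
  have hi : ∀ γ ∉ unitSpace G, invol u γ = 0 := by
    intro γ hγ
    rw [invol_apply, hu _ fun h => hγ ?_, star_zero]
    rw [← inv_inv' γ, inv_eq_self_of_r_eq_self h]
    exact h
  rw [conv_apply_of_left hi]
  by_cases hγ : γ ∈ unitSpace G
  · rw [mem_unitSpace.1 hγ, invol_apply, inv_eq_self_of_r_eq_self hγ]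
  · rw [hu γ hγ, mul_zero, mul_zero]

/-- With `k = √h`, the extension of `h` is `k^* * k` in the convolution algebra. -/
theorem IsState.apply_extendUnits_nonneg {ω : GroupoidCStar G →L[ℂ] ℂ} (hω : IsState ω)
    {h : C_c(unitSpace G, ℝ)} (hh : ∀ x, 0 ≤ h x) : 0 ≤ ω (toCStar (extendUnits h)) := by
  let k : C_c(unitSpace G, ℝ) :=
    { toFun := fun x => √(h x)
      continuous_toFun := h.continuous.sqrt
      hasCompactSupport' := h.hasCompactSupport.comp_left Real.sqrt_zero }
  have hk : extendUnits h = conv (invol (extendUnits k)) (extendUnits k) := by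
    ext γ
    rw [invol_conv_self_apply fun γ => extendUnits_apply_of_notMem k]
    by_cases hγ : γ ∈ unitSpace G
    · rw [extendUnits_apply_coe h ⟨γ, hγ⟩, extendUnits_apply_coe k ⟨γ, hγ⟩]
      change _ = star ((√(h ⟨γ, hγ⟩) : ℝ) : ℂ) * ((√(h ⟨γ, hγ⟩) : ℝ) : ℂ)
      rw [Complex.star_def, Complex.conj_ofReal, ← Complex.ofReal_mul, Real.mul_self_sqrt (hh _)]
    · rw [extendUnits_apply_of_notMem h hγ, extendUnits_apply_of_notMem k hγ, mul_zero]
  rw [hk, toCStar_conv, toCStar_invol]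
  exact hω.nonneg _

/-- The restriction of a state to `C_c(G⁽⁰⁾)`. -/
noncomputable def unitFunctional {ω : GroupoidCStar G →L[ℂ] ℂ} (hω : IsState ω) :
    C_c(unitSpace G, ℝ) →ₚ[ℝ] ℝ :=
  PositiveLinearMap.mk₀
    { toFun := fun h => (ω (toCStar (extendUnits h))).re
      map_add' := fun h k => by simp only [map_add, Complex.add_re]
      map_smul' := fun a h => by
        have : extendUnits (a • h) = (a : ℂ) • extendUnits h := by
          rw [map_smul]; rfl
        rw [this]
        simp [map_smul] }
    fun _ hh => (Complex.nonneg_iff.1 (hω.apply_extendUnits_nonneg hh)).1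

/-- Taking real parts in `unitFunctional` loses nothing: `ω` is real on nonnegative functions, and
`h` is a difference of two of them. -/
theorem ofReal_unitFunctional {ω : GroupoidCStar G →L[ℂ] ℂ} (hω : IsState ω)
    (h : C_c(unitSpace G, ℝ)) : (unitFunctional hω h : ℂ) = ω (toCStar (extendUnits h)) := by
  have key : ∀ k : C_c(unitSpace G, ℝ), (∀ x, 0 ≤ k x) →
      (ω (toCStar (extendUnits k))).im = 0 := fun k hk =>
    (Complex.nonneg_iff.1 (hω.apply_extendUnits_nonneg hk)).2.symm
  have hsub : h = (h ⊔ 0) - ((-h) ⊔ 0) := by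
    ext x
    change h x = max (h x) 0 - max (-h x) 0
    exact (posPart_sub_negPart (h x)).symm
  refine Complex.ext rfl ?_
  rw [Complex.ofReal_im, hsub, map_sub, map_sub, map_sub, Complex.sub_im,
    key _ fun x => le_max_right _ _, key _ fun x => le_max_right _ _, sub_zero]

theorem unitFunctional_le_one {ω : GroupoidCStar G →L[ℂ] ℂ} (hω : IsState ω)
    {h : C_c(unitSpace G, ℝ)} (hh : ∀ x, |h x| ≤ 1) : unitFunctional hω h ≤ 1 := by
  have h1 : INorm (extendUnits h) ≤ 1 :=
    INorm_le_one_of_support (fun γ => extendUnits_apply_of_notMem h)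
      (norm_extendUnits_le zero_le_one hh)
  calc unitFunctional hω h ≤ ‖ω (toCStar (extendUnits h))‖ := Complex.re_le_norm _
    _ ≤ ‖ω‖ * ‖toCStar (extendUnits h)‖ := ω.le_opNorm _
    _ ≤ 1 * 1 := by
      rw [hω.norm_eq_one]
      gcongr
      exact (norm_toCStar_le _).trans h1
    _ = 1 := one_mul 1

variable [LocallyCompactSpace G]

instance : LocallyCompactSpace (unitSpace G) :=
  (isClosed_unitSpace G).isClosedEmbedding_subtypeVal.locallyCompactSpace

variable [MeasurableSpace G] [BorelSpace G]

/-- The measure on the unit space representing the restriction of a state. -/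
noncomputable def unitMeasure {ω : GroupoidCStar G →L[ℂ] ℂ} (hω : IsState ω) :
    Measure (unitSpace G) :=
  RealRMK.rieszMeasure (unitFunctional hω)

instance {ω : GroupoidCStar G →L[ℂ] ℂ} (hω : IsState ω) : (unitMeasure hω).Regular :=
  RealRMK.regular_rieszMeasure _

theorem unitMeasure_univ_le {ω : GroupoidCStar G →L[ℂ] ℂ} (hω : IsState ω) :
    unitMeasure hω Set.univ ≤ 1 := by
  rw [isOpen_univ.measure_eq_iSup_isCompact]
  refine iSup₂_le fun K _ => iSup_le fun hK => ?_
  obtain ⟨f, h1, h2, -, h3⟩ := exists_continuousMap_one_of_isCompact_subset_isOpen hK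
    isOpen_univ (Set.subset_univ K)
  let g : C_c(unitSpace G, ℝ) := ⟨f, h2⟩
  refine (RealRMK.rieszMeasure_le_of_eq_one (unitFunctional hω) (f := g)
    (fun x => (h3 x).1) hK h1).trans ?_
  rw [ENNReal.ofReal_le_one]
  exact unitFunctional_le_one hω fun x => (abs_of_nonneg (h3 x).1).trans_le (h3 x).2

instance {ω : GroupoidCStar G →L[ℂ] ℂ} (hω : IsState ω) : IsFiniteMeasure (unitMeasure hω) :=
  ⟨(unitMeasure_univ_le hω).trans_lt ENNReal.one_lt_top⟩

theorem IsKMSState.isOmega_unitMeasure {c : RealCocycle G}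
    (hc : IsPrincipal {γ : G | c γ = 0}) {β : ℝ} {ω : GroupoidCStar G →L[ℂ] ℂ}
    (hω : IsKMSState (cocycleAction c) β ω)
    (hβ : β = 0 → ∀ (t : ℝ) (a : GroupoidCStar G), ω (cocycleAction c t a) = ω a) :
    IsOmega (unitMeasure hω.toIsState) ω := by
  intro f
  have hint : Integrable (fun x : unitSpace G => f x) (unitMeasure hω.toIsState) :=
    (f.continuous.comp continuous_subtype_val).integrable_of_hasCompactSupport
      (f.hasCompactSupport.comp_isClosedEmbedding
        (isClosed_unitSpace G).isClosedEmbedding_subtypeVal)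
  have hf : ω (toCStar f) = ω (toCStar (extendUnits (restrictUnits Complex.reCLM f) +
      Complex.I • extendUnits (restrictUnits Complex.imCLM f))) := by
    refine hω.apply_congr hc hβ fun x => ?_
    change f x = extendUnits (restrictUnits Complex.reCLM f) x +
      Complex.I * extendUnits (restrictUnits Complex.imCLM f) x
    rw [extendUnits_apply_coe, extendUnits_apply_coe, mul_comm]
    exact (Complex.re_add_im (f x)).symm
  rw [hf, map_add, map_add, map_smul, map_smul, ← ofReal_unitFunctional hω.toIsState,
    ← ofReal_unitFunctional hω.toIsState, ← RealRMK.integral_rieszMeasure,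
    ← RealRMK.integral_rieszMeasure, ← integral_re_add_im hint, smul_eq_mul, mul_comm]
  rfl

/-- As `C*(G)` need not be unital, local units replace the unit. If `u * f = f`, Cauchy–Schwarz
gives `|ω(f)|² ≤ ω(u^* u) ω(f^* f) ≤ μ(G⁽⁰⁾) ‖f‖²`. By density `1 = ‖ω‖ ≤ √μ(G⁽⁰⁾)`. -/
theorem isProbabilityMeasure_of_isOmega {ω : GroupoidCStar G →L[ℂ] ℂ} (hω : IsState ω)
    {μ : Measure (unitSpace G)} [IsFiniteMeasure μ] (hμ1 : μ Set.univ ≤ 1) (hμ : IsOmega μ ω) :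
    IsProbabilityMeasure μ := by
  have hdense : ∀ a, ‖ω a‖ ≤ √(μ.real Set.univ) * ‖a‖ := by
    intro a
    refine (denseRange_toCStar (G := G)).induction_on (p := fun a => ‖ω a‖ ≤ _ * ‖a‖) a
      (isClosed_le ω.continuous.norm (continuous_const.mul continuous_norm)) fun f => ?_
    obtain ⟨u, h1, h2, h3⟩ := exists_local_unit f
    have hu : invol u = u := by
      ext γ
      rw [invol_apply]
      by_cases hγ : γ ∈ unitSpace G
      · obtain ⟨t, ht, -⟩ := h2 γ
        rw [inv_eq_self_of_r_eq_self hγ, ht, Complex.star_def, Complex.conj_ofReal]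
      · rw [h1 γ hγ, h1 _ fun h => hγ ?_, star_zero]
        rw [← inv_inv' γ, inv_eq_self_of_r_eq_self h]
        exact h
    have hf : toCStar f = star (toCStar u) * toCStar f := by
      rw [← toCStar_invol, hu, ← toCStar_conv, (h3 f fun _ h => h).1]
    have hcs := hω.norm_sq_apply_le (toCStar u) (toCStar f)
    rw [← hf] at hcs
    have huu : ‖ω (star (toCStar u) * toCStar u)‖ ≤ μ.real Set.univ := by
      rw [← toCStar_invol, ← toCStar_conv, hμ]
      refine (norm_integral_le_of_norm_le_const (C := 1) (.of_forall fun x => ?_)).trans_eq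
        (one_mul _)
      obtain ⟨t, ht, ht0, ht1⟩ := h2 x
      rw [invol_conv_self_apply h1, ht, norm_mul, norm_star, Complex.norm_real,
        Real.norm_of_nonneg ht0]
      exact mul_le_one₀ ht1 ht0 ht1
    have hff : ‖ω (star (toCStar f) * toCStar f)‖ ≤ ‖toCStar f‖ ^ 2 := by
      refine (ω.le_opNorm _).trans_eq ?_
      rw [hω.norm_eq_one, one_mul, CStarRing.norm_star_mul_self, sq]
    refine abs_le_of_sq_le_sq' ?_ (by positivity) |>.2
    rw [mul_pow, Real.sq_sqrt measureReal_nonneg]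
    exact hcs.trans (mul_le_mul huu hff (norm_nonneg _) measureReal_nonneg)
  have h1 : 1 ≤ √(μ.real Set.univ) := by
    rw [← hω.norm_eq_one]
    exact ω.opNorm_le_bound (Real.sqrt_nonneg _) hdense
  refine ⟨le_antisymm hμ1 ?_⟩
  rw [Real.one_le_sqrt] at h1
  rw [← ENNReal.ofReal_one, ← ofReal_measureReal (μ := μ)]
  exact ENNReal.ofReal_le_ofReal h1

end UnitMeasure

/-! ### The modular function and quasi-invariance -/

section Modular

open MeasureTheory

variable {G : Type u} [TopologicalSpace G] [EtaleGroupoid G] [T2Space G]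
  [LocallyCompactSpace G] [MeasurableSpace G] [BorelSpace G]

instance (μ : Measure (unitSpace G)) [IsFiniteMeasure μ] : (rStar μ).Regular :=
  RealRMK.regular_rieszMeasure _

instance (μ : Measure (unitSpace G)) [IsFiniteMeasure μ] : (sStar μ).Regular :=
  RealRMK.regular_rieszMeasure _

theorem integral_rStar (μ : Measure (unitSpace G)) [IsFiniteMeasure μ] (f : C_c(G, ℝ)) :
    ∫ γ, f γ ∂(rStar μ) = ∫ x, fibreSum (rMap G) f x ∂μ :=
  RealRMK.integral_rieszMeasure _ f

theorem integral_sStar (μ : Measure (unitSpace G)) [IsFiniteMeasure μ] (f : C_c(G, ℝ)) :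
    ∫ γ, f γ ∂(sStar μ) = ∫ x, fibreSum (sMap G) f x ∂μ :=
  RealRMK.integral_rieszMeasure _ f

theorem ofReal_fibreSum {p : G → unitSpace G} (hp : IsLocalHomeomorph p) (f : C_c(G, ℝ))
    (x : unitSpace G) :
    ((fibreSum p f x : ℝ) : ℂ) = fibreSum p (fun γ => (f γ : ℂ)) x :=
  Complex.ofRealHom.toAddMonoidHom.map_finsum_mem' (finite_fibre_support hp f x)

theorem IsKMSState.hasModularFunction {c : RealCocycle G} {β : ℝ}
    {ω : GroupoidCStar G →L[ℂ] ℂ} (hω : IsKMSState (cocycleAction c) β ω)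
    (μ : Measure (unitSpace G)) [IsFiniteMeasure μ] (hμ : IsOmega μ ω) :
    HasModularFunction μ fun γ => Real.exp (-β * c γ) := by
  have hD : Continuous fun γ => Real.exp (-β * c γ) := by
    have := c.continuous_toFun
    fun_prop
  refine eq_withDensity_of_integral_eq _ _ hD (fun γ => Real.exp_pos _) fun f => ?_
  let g : C_c(G, ℝ) :=
    { toFun := fun γ => Real.exp (-β * c γ) * f γ
      continuous_toFun := hD.mul f.continuous
      hasCompactSupport' := f.hasCompactSupport.mul_left }
  let fC : C_c(G, ℂ) :=
    { toFun := fun γ => f γ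
      continuous_toFun := Complex.continuous_ofReal.comp f.continuous
      hasCompactSupport' := f.hasCompactSupport.comp_left (g := fun t : ℝ => (t : ℂ)) (by simp) }
  obtain ⟨k, hk, -, -⟩ := exists_cc_eq_one f.hasCompactSupport.isCompact isOpen_univ
    (Set.subset_univ _)
  have hfk : ∀ γ, (f γ : ℂ) * star (k γ) = f γ := by
    intro γ
    by_cases hγ : f γ = 0
    · rw [hγ, Complex.ofReal_zero, zero_mul]
    · rw [hk γ (subset_tsupport _ hγ), star_one, mul_one]
  -- Both sides become integrals over units: `∑_{s(γ)=x} e^{-βc} f` on the left and `∑_{r(γ)=x} f`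
  -- on the right.
  have h := hω.apply_conv fC (invol k)
  rw [hμ, hμ] at h
  have hr : ∀ x : unitSpace G, conv fC (invol k) x = ((fibreSum (rMap G) f x : ℝ) : ℂ) := by
    intro x
    rw [conv_invol_apply, ofReal_fibreSum isLocalHomeomorph_rMap]
    exact congrArg (fun F : G → ℂ => fibreSum (rMap G) F x) (funext hfk)
  have hs : ∀ x : unitSpace G, conv (invol k) (mulCc (c.expI (Complex.I * β)) fC) x =
      ((fibreSum (sMap G) g x : ℝ) : ℂ) := by
    intro x
    rw [invol_conv_apply, ofReal_fibreSum isLocalHomeomorph_sMap]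
    refine congrArg (fun F : G → ℂ => fibreSum (sMap G) F x) (funext fun γ => ?_)
    change star (k γ) * (c.expI (Complex.I * β) γ * (f γ : ℂ)) =
      ((Real.exp (-β * c γ) * f γ : ℝ) : ℂ)
    rw [c.expI_I_mul, Complex.ofReal_mul, mul_left_comm, mul_comm (star (k γ)), hfk]
  simp only [hr, hs, integral_complex_ofReal, Complex.ofReal_inj] at h
  rw [integral_rStar, ← h, ← integral_sStar]
  rfl

/-- A density always gives `rStar μ ≪ sStar μ`; strict positivity of `D` gives the converse. -/
theorem HasModularFunction.isQuasiInvariant {μ : Measure (unitSpace G)} [IsFiniteMeasure μ]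
    {D : G → ℝ} (hD : Measurable D) (hpos : ∀ γ, 0 < D γ) (h : HasModularFunction μ D) :
    IsQuasiInvariant μ := by
  unfold HasModularFunction at h
  rw [IsQuasiInvariant, h]
  exact ⟨withDensity_absolutelyContinuous _ _, withDensity_absolutelyContinuous'
    hD.ennreal_ofReal.aemeasurable (.of_forall fun γ => by simpa using hpos γ)⟩

end Modular

end EtaleKMS

theorem proposition3p2 {G : Type*} [TopologicalSpace G] [EtaleGroupoid G] [T2Space G]
    [LocallyCompactSpace G] [MeasurableSpace G] [BorelSpace G]
    (c : RealCocycle G) (hc : IsPrincipal {γ : G | c γ = 0})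
    (β : ℝ) (ω : GroupoidCStar G →L[ℂ] ℂ)
    (hω : IsKMSState (cocycleAction c) β ω)
    -- at inverse temperature zero, invariance is required separately
    (hβ : β = 0 → ∀ (t : ℝ) (a : GroupoidCStar G), ω (cocycleAction c t a) = ω a) :
    ∃ (μ : MeasureTheory.Measure (unitSpace G)) (_ : MeasureTheory.IsProbabilityMeasure μ),
      μ.Regular ∧
      IsQuasiInvariant μ ∧
      HasModularFunction μ (fun γ => Real.exp (-β * c γ)) ∧
      IsOmega μ ω := by
  have hμ := hω.isOmega_unitMeasure hc hβ
  have hmod := hω.hasModularFunction (unitMeasure hω.toIsState) hμ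
  have hmeas : Measurable fun γ => Real.exp (-β * c γ) := by
    have := c.continuous_toFun.measurable
    fun_prop
  exact ⟨unitMeasure hω.toIsState,
    isProbabilityMeasure_of_isOmega hω.toIsState (unitMeasure_univ_le _) hμ, inferInstance,
    hmod.isQuasiInvariant hmeas fun γ => Real.exp_pos _, hmod, hμ⟩
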